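/- **Notation.** $\Omega^k$ denotes the formal differential $k$-forms in $x_1,x_2,x_3$ over $\mathbb{C}$, so $\Omega^0=\mathbb{C}[[x_1,x_2,x_3]]$; $W_3$ denotes the formal vector fields and $\Omega^2_{cl}=d\Omega^1$ the closed 2-forms. Via $\Omega^0\simeq\Omega^3$, $f\mapsto f\,dx_1\wedge dx_2\wedge dx_3$, and $W_3\simeq\Omega^2$, $D\mapsto\iota_D(dx_1\wedge dx_2\wedge dx_3)$, we regard 3-forms as functions and 2-forms as vector fields. Let $\epsilon^+,\epsilon^-$ be the standard basis of $\mathbb{C}^2$, let $\epsilon^+\wedge\epsilon^-=1$, and let $v\cdot v'\in S^2\mathbb{C}^2\simeq sl_2(\mathbb{C})$ with $\epsilon^+\cdot\epsilon^+=\begin{pmatrix}0&1\\0&0\end{pmatrix}$, $\epsilon^-\cdot\epsilon^-=\begin{pmatrix}0&0\\-1&0\end{pmatrix}$, $\epsilon^+\cdot\epsilon^-=\tfrac12\begin{pmatrix}-1&0\\0&1\end{pmatrix}$. **The Lie superalgebra $L=E(3,8)$.** $L_{\bar 0}=W_3\oplus(\Omega^0\otimes sl_2(\mathbb{C}))\oplus\Omega^2_{cl}$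 and $L_{\bar1}=(\Omega^0\oplus\Omega^2)\otimes\mathbb{C}^2$. For $X,Y\in W_3$, $f,g\in\Omega^0$, $A,B\in sl_2(\mathbb{C})$, $w,w'\in\Omega^2_{cl}$, $\sigma,\tau\in\Omega^2$, $v,v'\in\mathbb{C}^2$ the brackets are $$[X,Y]=[X,Y]_{W_3}-\tfrac12\,d(\operatorname{div}X)\wedge d(\operatorname{div}Y),\quad [X,f\otimes A]=Xf\otimes A,\quad [X,w]=\mathcal{L}_Xw,$$ $$[f\otimes A,g\otimes B]=fg\otimes[A,B]+\operatorname{tr}(AB)\,df\wedge dg,\quad [f\otimes A,w]=[w,w']=0,$$ $$[X,f\otimes v]=(Xf-\tfrac12(\operatorname{div}X)f)\otimes v+\tfrac12\,d(\operatorname{div}X)\wedge df\otimes v,\quad [X,\sigma\otimes v]=(\mathcal{L}_X\sigma-\tfrac12(\operatorname{div}X)\sigma)\otimes v,$$ $$[g\otimes A,f\otimes v]=gf\otimes Av+dg\wedge df\otimes Av,\quad [g\otimes A,\sigma\otimes v]=g\sigma\otimes Av,\quad [w,f\otimes v]=fw\otimes v,\quad [w,\sigma\otimes v]=0,$$ $$[f\otimes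 v,g\otimes v']=-(df\wedge dg)\,(v\wedge v')\in W_3,\qquad [\sigma\otimes v,\tau\otimes v']=d(\iota_\tau\sigma)\,(v\wedge v')\in\Omega^2_{cl},$$ $$[f\otimes v,\tau\otimes v']=-(f\tau)\,(v\wedge v')-(df\wedge\tau-f\,d\tau)\otimes(v\cdot v')-df\wedge d(d\tau)\,(v\wedge v')\in W_3\oplus(\Omega^0\otimes sl_2)\oplus\Omega^2_{cl},$$ where in $f\tau$ and $\iota_\tau$ the 2-form $\tau$ is read as a vector field, and in $d(d\tau)$ the 3-form $d\tau$ is read as a function. The algebra $L$ is graded by $\deg x_i=-\deg\partial_i=\deg dx_i=2$, $\deg\epsilon^\pm=-3$, $\deg sl_2(\mathbb{C})=0$. Let $\mathfrak g_0$ be its part of degree $0$, so $\mathfrak g_0=\langle x_i\partial_j\rangle\oplus sl_2(\mathbb{C})=sl_3(\mathbb{C})\oplus sl_2(\mathbb{C})\oplus\mathbb{C}Y$ with $Y=\tfrac23\sum_i x_i\partial_i\in W_3$, and let $L_0$ be the subalgebra of elements all of whose homogeneous components have degree $\ge0$. For a $\mathfrak g_0$-module $V$ let $M(V)=U(L)\otimes_{U(L_0)}V$,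 where elements of positive degree act on $V$ by $0$. Put $d_i^{a}=x_i\otimes\epsilon^{a}\in L_{\bar1}$ ($i=1,2,3$, $a=\pm$). **The modules.** Let $H$ be the Weyl algebra generated by $x_i,z_a,\partial_i,\partial_a$ ($i=1,2,3$, $a=\pm$) with $[\partial_i,x_j]=\delta_{ij}$, $[\partial_a,z_b]=\delta_{ab}$ and all other commutators zero. Let $L_A=\langle x_i,z_a\rangle$, $L_B=\langle x_i,\partial_a\rangle$, $L_C=\langle\partial_i,z_a\rangle$, $L_D=\langle\partial_i,\partial_a\rangle$. For $X\in\{A,B,C,D\}$ let $L_X'$ be the span of those of these generators that do not lie in $L_X$, and $V_X=H/HL'_X=S(L_X)\mathbf 1_X$. The algebra $\mathfrak g_0$ acts on $V_X$ through $H$: a traceless matrix $(a_{ij})$, i.e. $\sum a_{ij}x_i\partial_j\in sl_3(\mathbb{C})$, by $\sum a_{ij}x_i\partial_j$; a matrix $(s_{ab})\in sl_2(\mathbb{C})$ by $\sum s_{ab}z_a\partial_b$; and $Y$ by $-\tfrac43\sum_i x_i\partial_i+\sum_a z_a\partial_a$. The subspaces $V_{A''}=\mathbb{C}[z_+,z_-]\mathbf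 1_A$, $V_{B''}=\mathbb{C}[\partial_+,\partial_-]\mathbf 1_B$, $V_{C''}=\mathbb{C}[z_+,z_-]\mathbf 1_C$, $V_{D''}=\mathbb{C}[\partial_+,\partial_-]\mathbf 1_D$ are $\mathfrak g_0$-submodules. Put $M_{X''}=M(V_{X''})$, which maps to $M(V_X)$ by the morphism induced by $V_{X''}\subset V_X$. Let $\nabla:M(V_X)\to M(V_X)$ be given by $$\nabla(u\otimes v)=\sum_{i}\sum_{a=\pm}u\,d_i^a\otimes\partial_i\partial_a v .$$ **Proposition.** For each $X$ the map $\nabla$ is a well-defined morphism of $E(3,8)$-modules, and: (a) The formula $$\nabla_3(u\otimes f\mathbf 1_X)=\sum_{a,b,c=\pm}u\,d_1^ad_2^bd_3^c\otimes\partial_a\partial_b\partial_c\,f\mathbf 1_{Y}$$ gives well-defined morphisms of $E(3,8)$-modules $\nabla_3:M_{A''}\to M_{C''}$ (here $X=A$, $Y=C$, $f\in\mathbb{C}[z_+,z_-]$) and $\nabla_3:M_{B''}\to M_{D''}$ (here $X=B$, $Y=D$, $f\in\mathbb{C}[\partial_+,\partial_-]$). (b) $\nabla\nabla_3=0$ as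 maps $M_{A''}\to M(V_C)$ and $M_{B''}\to M(V_D)$; and $\nabla_3\nabla=0$ wherever the composition is defined, that is: if $m\in M(V_A)$ (resp. $m\in M(V_B)$) and $\nabla m$ is the image of $n\in M_{A''}$ (resp. $n\in M_{B''}$), then $\nabla_3 n=0$. -/

import Mathlib

open scoped Matrix TensorProduct

noncomputable section

namespace E38

attribute [local instance 100] LieRing.ofAssociativeRing

/-! ### Lie superalgebras and their universal enveloping algebras -/

section Super

variable (L₀ L₁ : Type) [LieRing L₀] [LieAlgebra ℂ L₀] [AddCommGroup L₁] [Module ℂ L₁]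
  [LieRingModule L₀ L₁] [LieModule ℂ L₀ L₁]

/-- A complex Lie superalgebra `L₀ ⊕ L₁`: the even part `L₀` is a Lie algebra, the odd part `L₁` is
an `L₀`-module, and there is a symmetric `L₀`-equivariant bilinear bracket `L₁ × L₁ → L₀` that
satisfies the Jacobi identity for three odd elements. -/
class LieSuperalgebra where
  oddBracket : L₁ →ₗ[ℂ] L₁ →ₗ[ℂ] L₀
  oddBracket_symm : ∀ a b : L₁, oddBracket a b = oddBracket b a
  lie_oddBracket : ∀ (x : L₀) (a b : L₁),
    ⁅x, oddBracket a b⁆ = oddBracket ⁅x, a⁆ b + oddBracket a ⁅x, b⁆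
  jacobi_odd : ∀ a b c : L₁,
    ⁅oddBracket a b, c⁆ + ⁅oddBracket b c, a⁆ + ⁅oddBracket c a, b⁆ = 0

variable [LieSuperalgebra L₀ L₁]

/-- The relations `u v - (-1)^{|u||v|} v u = [u, v]` of the universal enveloping algebra, for
homogeneous `u`, `v`. -/
inductive EnvRel : TensorAlgebra ℂ (L₀ × L₁) → TensorAlgebra ℂ (L₀ × L₁) → Prop
  | even_even (x y : L₀) : EnvRel
      (TensorAlgebra.ι ℂ (x, 0) * TensorAlgebra.ι ℂ (y, 0))
      (TensorAlgebra.ι ℂ (y, 0) * TensorAlgebra.ι ℂ (x, 0) + TensorAlgebra.ι ℂ (⁅x, y⁆, 0))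
  | even_odd (x : L₀) (a : L₁) : EnvRel
      (TensorAlgebra.ι ℂ (x, 0) * TensorAlgebra.ι ℂ (0, a))
      (TensorAlgebra.ι ℂ (0, a) * TensorAlgebra.ι ℂ (x, 0) + TensorAlgebra.ι ℂ (0, ⁅x, a⁆))
  | odd_odd (a b : L₁) : EnvRel
      (TensorAlgebra.ι ℂ (0, a) * TensorAlgebra.ι ℂ (0, b))
      (-(TensorAlgebra.ι ℂ (0, b) * TensorAlgebra.ι ℂ (0, a)) +
        TensorAlgebra.ι ℂ (LieSuperalgebra.oddBracket a b, 0))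

/-- The universal enveloping algebra `U(L)` of the Lie superalgebra `L = L₀ ⊕ L₁`.  Modules over
the Lie superalgebra `L` are the same as left modules over the ring `U(L)`. -/
def Env : Type := RingQuot (EnvRel L₀ L₁)

instance : Ring (Env L₀ L₁) := inferInstanceAs (Ring (RingQuot (EnvRel L₀ L₁)))

instance : Algebra ℂ (Env L₀ L₁) := inferInstanceAs (Algebra ℂ (RingQuot (EnvRel L₀ L₁)))

/-- The canonical map from the even part to the enveloping algebra. -/
def ofEven : L₀ →ₗ[ℂ] Env L₀ L₁ :=
  (RingQuot.mkAlgHom ℂ (EnvRel L₀ L₁)).toLinearMap ∘ₗ TensorAlgebra.ι ℂ ∘ₗ LinearMap.inl ℂ L₀ L₁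

/-- The canonical map from the odd part to the enveloping algebra. -/
def ofOdd : L₁ →ₗ[ℂ] Env L₀ L₁ :=
  (RingQuot.mkAlgHom ℂ (EnvRel L₀ L₁)).toLinearMap ∘ₗ TensorAlgebra.ι ℂ ∘ₗ LinearMap.inr ℂ L₀ L₁

end Super

/-! ### Formal functions, vector fields and differential forms in three variables -/

/-- The algebra `ℂ[[x₁, x₂, x₃]]` of formal power series, i.e. `Ω⁰(3)`; the variables are indexed
by `0, 1, 2`. -/
abbrev O : Type := MvPowerSeries (Fin 3) ℂ

/-- The partial derivative `∂ᵢ`. -/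
def pd (i : Fin 3) : Derivation ℂ O O := MvPowerSeries.pderiv ℂ i

theorem pd_comm (i j : Fin 3) (f : O) : pd i (pd j f) = pd j (pd i f) := by
  ext n
  rcases eq_or_ne i j with rfl | h
  · rfl
  · simp only [pd, MvPowerSeries.coeff_pderiv, Finsupp.add_apply, Finsupp.single_eq_of_ne h,
      Finsupp.single_eq_of_ne h.symm, add_right_comm n]
    push_cast
    ring

/-- Triples of formal power series.  A triple `u` stands, according to the context, for
* the vector field `u₁ ∂₁ + u₂ ∂₂ + u₃ ∂₃` in `W₃`,
* the 1-form `u₁ dx₁ + u₂ dx₂ + u₃ dx₃`,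
* the 2-form `u₁ dx₂ ∧ dx₃ + u₂ dx₃ ∧ dx₁ + u₃ dx₁ ∧ dx₂`.
A 3-form `f dx₁ ∧ dx₂ ∧ dx₃` is given by `f`.  In these coordinates the isomorphisms
`W₃ ≃ Ω²(3)^{-1}`, `D ↦ ι_D (dx₁ ∧ dx₂ ∧ dx₃)`, and `Ω⁰(3) ≃ Ω³(3)^{-1}` are identity maps, the
wedge product of two 1-forms is the cross product `⨯₃`, the wedge product of a 1-form and a 2-form
is the dot product `⬝ᵥ`, and the contraction of a 2-form `w` with a vector field `X` is
`w ⨯₃ X`. -/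
abbrev Vec : Type := Fin 3 → O

/-- The differential of a function. -/
def d0 (f : O) : Vec := fun i => pd i f

/-- The differential of a 1-form. -/
def d1 (u : Vec) : Vec :=
  ![pd 1 (u 2) - pd 2 (u 1), pd 2 (u 0) - pd 0 (u 2), pd 0 (u 1) - pd 1 (u 0)]

/-- The differential of a 2-form; also the divergence of a vector field. -/
def d2 (w : Vec) : O := pd 0 (w 0) + pd 1 (w 1) + pd 2 (w 2)

/-- The action of a vector field on a function. -/
def lieFun (X : Vec) (f : O) : O := ∑ j, X j * pd j f

/-- The bracket of two vector fields. -/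
def lieVec (X Y : Vec) : Vec := fun i => lieFun X (Y i) - lieFun Y (X i)

/-- The Lie derivative of a 2-form along a vector field, by the formula of Cartan
`L_X w = d (ι_X w) + ι_X (d w)`. -/
def lieForm2 (X w : Vec) : Vec := d1 (w ⨯₃ X) + d2 w • X

/-- `2 × 2` matrices of formal power series. -/
abbrev Mat : Type := Matrix (Fin 2) (Fin 2) O

/-! ### The components of the brackets

An even element of `E(3,8)` is a triple `(X, s, w)`: a vector field `X` in `W₃`, a traceless matrix
`s` in `sl₂(Ω⁰(3))`, and a closed 2-form `w`.  An odd element is a pair `(f, σ)` that stands for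
`∑ₐ fₐ ⊗ εᵃ + ∑ₐ σₐ ⊗ εᵃ`, with functions `fₐ` in `Ω⁰(3)^{-1/2}` and 2-forms `σₐ` in
`Ω²(3)^{-1/2}`; here `ε⁺`, `ε⁻` is the standard basis of `ℂ²`, indexed by `0`, `1`, and
`ε⁺ ∧ ε⁻ = 1`. -/

/-- The `sl₂`-component of the bracket of two even elements. -/
def eeSl (X : Vec) (s : Mat) (Y : Vec) (t : Mat) : Mat :=
  t.map (lieFun X) - s.map (lieFun Y) + (s * t - t * s)

/-- The 2-form component of the bracket of two even elements: the Lie derivatives, together with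
`[X, Y] ↦ -1/2 d(div X) ∧ d(div Y)` and `[f ⊗ A, g ⊗ B] ↦ tr(AB) df ∧ dg`. -/
def eeForm (X : Vec) (s : Mat) (w : Vec) (Y : Vec) (t : Mat) (v : Vec) : Vec :=
  lieForm2 X v - lieForm2 Y w - (1 / 2 : ℂ) • (d0 (d2 X) ⨯₃ d0 (d2 Y)) +
    ∑ a, ∑ b, d0 (s a b) ⨯₃ d0 (t b a)

/-- The function component of the bracket of an even and an odd element. -/
def eo0 (X : Vec) (s : Mat) (f : Fin 2 → O) : Fin 2 → O := fun a =>
  lieFun X (f a) - (1 / 2 : ℂ) • (d2 X * f a) + ∑ b, s a b * f b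

/-- The 2-form component of the bracket of an even and an odd element: the Lie derivative (twisted
by `-1/2 div`) and multiplication by functions, together with
`[X, f ⊗ v] ↦ 1/2 d(div X) ∧ df ⊗ v`, `[g ⊗ A, f ⊗ v] ↦ dg ∧ df ⊗ A v`, `[w, f ⊗ v] ↦ f w ⊗ v`. -/
def eo2 (X : Vec) (s : Mat) (w : Vec) (f : Fin 2 → O) (σ : Fin 2 → Vec) : Fin 2 → Vec := fun a =>
  lieForm2 X (σ a) - (1 / 2 : ℂ) • (d2 X • σ a) + ∑ b, s a b • σ b
    + (1 / 2 : ℂ) • (d0 (d2 X) ⨯₃ d0 (f a)) + ∑ b, d0 (s a b) ⨯₃ d0 (f b) + f a • w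

/-- The vector field component of the bracket of two odd elements:
`[f ⊗ v, g ⊗ v'] ↦ -(df ∧ dg) (v ∧ v')`, `[f ⊗ v, τ ⊗ v'] ↦ -(f τ) (v ∧ v')`. -/
def ooVec (f : Fin 2 → O) (σ : Fin 2 → Vec) (g : Fin 2 → O) (τ : Fin 2 → Vec) : Vec :=
  -(d0 (f 0) ⨯₃ d0 (g 1) - d0 (f 1) ⨯₃ d0 (g 0)) - (f 0 • τ 1 - f 1 • τ 0) - (g 0 • σ 1 - g 1 • σ 0)

/-- The 3-form `df ∧ τ - f dτ`. -/
def ooK (f : O) (τ : Vec) : O := d0 f ⬝ᵥ τ - f * d2 τ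

/-- The `sl₂`-component of the bracket of two odd elements,
`[f ⊗ v, τ ⊗ v'] ↦ -(df ∧ τ - f dτ) ⊗ (v · v')`, for the identification `S²(ℂ²) = sl₂(ℂ)`
`ε⁺ · ε⁺ = (0 1; 0 0)`, `ε⁻ · ε⁻ = (0 0; -1 0)`, `ε⁺ · ε⁻ = (-1/2 0; 0 1/2)`. -/
def ooSl (f : Fin 2 → O) (σ : Fin 2 → Vec) (g : Fin 2 → O) (τ : Fin 2 → Vec) : Mat :=
  let k : Fin 2 → Fin 2 → O := fun a b => ooK (f a) (τ b) + ooK (g b) (σ a)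
  !![(1 / 2 : ℂ) • (k 0 1 + k 1 0), - k 0 0; k 1 1, -(1 / 2 : ℂ) • (k 0 1 + k 1 0)]

/-- The 2-form component of the bracket of two odd elements:
`[σ ⊗ v, τ ⊗ v'] ↦ d(ι_τ σ) (v ∧ v')`, where `τ` is contracted as a vector field, and
`[f ⊗ v, τ ⊗ v'] ↦ -(df ∧ d(dτ)) (v ∧ v')`, where the 3-form `dτ` is read as a function. -/
def ooForm (f : Fin 2 → O) (σ : Fin 2 → Vec) (g : Fin 2 → O) (τ : Fin 2 → Vec) : Vec :=
  d1 (σ 0 ⨯₃ τ 1 - σ 1 ⨯₃ τ 0) - (d0 (f 0) ⨯₃ d0 (d2 (τ 1)) - d0 (f 1) ⨯₃ d0 (d2 (τ 0)))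
    - (d0 (g 0) ⨯₃ d0 (d2 (σ 1)) - d0 (g 1) ⨯₃ d0 (d2 (σ 0)))

/-! ### Calculus lemmas and the Jacobi identities -/

section Jacobi

set_option linter.unusedSimpArgs false
set_option linter.unusedVariables false

theorem pd_mul (i : Fin 3) (f g : O) : pd i (f * g) = f * pd i g + g * pd i f := (pd i).leibniz f g
theorem pd_smul (i : Fin 3) (c : ℂ) (g : O) : pd i (c • g) = c • pd i g := (pd i).map_smul c g
theorem pd_add (i : Fin 3) (f g : O) : pd i (f + g) = pd i f + pd i g := map_add _ _ _
theorem pd_sub (i : Fin 3) (f g : O) : pd i (f - g) = pd i f - pd i g := map_sub _ _ _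
theorem pd_neg (i : Fin 3) (f : O) : pd i (-f) = -pd i f := map_neg _ _
theorem pd10 (f : O) : pd 1 (pd 0 f) = pd 0 (pd 1 f) := pd_comm _ _ _
theorem pd20 (f : O) : pd 2 (pd 0 f) = pd 0 (pd 2 f) := pd_comm _ _ _
theorem pd21 (f : O) : pd 2 (pd 1 f) = pd 1 (pd 2 f) := pd_comm _ _ _

theorem d0_add (f g : O) : d0 (f + g) = d0 f + d0 g := by ext1 i; simp [d0, pd_add]
theorem d0_sub (f g : O) : d0 (f - g) = d0 f - d0 g := by ext1 i; simp [d0, pd_sub]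
theorem d0_neg (f : O) : d0 (-f) = -d0 f := by ext1 i; simp [d0, pd_neg]
theorem d0_smul (c : ℂ) (f : O) : d0 (c • f) = c • d0 f := by ext1 i; simp [d0, pd_smul]
theorem d0_mul (f g : O) : d0 (f * g) = f • d0 g + g • d0 f := by ext1 i; simp [d0, pd_mul]
theorem lieFun_mul (X : Vec) (f g : O) : lieFun X (f * g) = f * lieFun X g + g * lieFun X f := by
  simp only [lieFun, Fin.sum_univ_three, pd_mul]; ring
theorem lieFun_lieVec (X Y : Vec) (f : O) :
    lieFun (lieVec X Y) f = lieFun X (lieFun Y f) - lieFun Y (lieFun X f) := by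
  simp only [lieFun, lieVec, Fin.sum_univ_three, pd_mul, pd_add, pd10, pd20, pd21]; ring
theorem d2_lieVec (X Y : Vec) : d2 (lieVec X Y) = lieFun X (d2 Y) - lieFun Y (d2 X) := by
  simp only [lieFun, lieVec, d2, Fin.sum_univ_three, pd_mul, pd_add, pd_sub, pd10, pd20, pd21]; ring
theorem lieForm2_apply (X w : Vec) (i : Fin 3) :
    lieForm2 X w i = lieFun X (w i) - lieFun w (X i) + d2 X * w i := by
  fin_cases i <;>
  simp [lieFun, lieForm2, d1, d2, Fin.sum_univ_three, pd_mul, pd_add, pd_sub, cross_apply] <;> ring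
theorem lieFun_add (X : Vec) (f g : O) : lieFun X (f + g) = lieFun X f + lieFun X g := by
  simp only [lieFun, Fin.sum_univ_three, pd_add]; ring
theorem lieFun_sub (X : Vec) (f g : O) : lieFun X (f - g) = lieFun X f - lieFun X g := by
  simp only [lieFun, Fin.sum_univ_three, pd_sub]; ring
theorem lieFun_neg (X : Vec) (f : O) : lieFun X (-f) = -lieFun X f := by
  simp only [lieFun, Fin.sum_univ_three, pd_neg]; ring
theorem lieFun_smul (X : Vec) (c : ℂ) (f : O) : lieFun X (c • f) = c • lieFun X f := by
  simp only [lieFun, Fin.sum_univ_three, pd_smul, smul_add, mul_smul_comm]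
theorem lieForm2_add (X v w : Vec) : lieForm2 X (v + w) = lieForm2 X v + lieForm2 X w := by
  ext1 i; simp only [lieForm2_apply, Pi.add_apply, lieFun, Fin.sum_univ_three, pd_add]; ring
theorem lieForm2_sub (X v w : Vec) : lieForm2 X (v - w) = lieForm2 X v - lieForm2 X w := by
  ext1 i; simp only [lieForm2_apply, Pi.sub_apply, lieFun, Fin.sum_univ_three, pd_sub]; ring
theorem lieForm2_neg (X v : Vec) : lieForm2 X (-v) = -lieForm2 X v := by
  ext1 i; simp only [lieForm2_apply, Pi.neg_apply, lieFun, Fin.sum_univ_three, pd_neg]; ring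
theorem lieForm2_smul (X : Vec) (c : ℂ) (w : Vec) : lieForm2 X (c • w) = c • lieForm2 X w := by
  ext1 i; simp only [lieForm2_apply, Pi.smul_apply, lieFun, Fin.sum_univ_three, pd_smul]; algebra
theorem lieForm2_fsmul (X : Vec) (f : O) (w : Vec) :
    lieForm2 X (f • w) = lieFun X f • w + f • lieForm2 X w := by
  ext1 i
  simp only [lieForm2_apply, Pi.smul_apply, Pi.add_apply, smul_eq_mul, lieFun, Fin.sum_univ_three,
    pd_mul]; ring
theorem lieForm2_lieVec (X Y w : Vec) :
    lieForm2 (lieVec X Y) w = lieForm2 X (lieForm2 Y w) - lieForm2 Y (lieForm2 X w) := by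
  ext1 i
  simp only [Pi.sub_apply, lieForm2_apply, d2_lieVec, lieFun_lieVec]
  simp only [lieVec, lieFun, Fin.sum_univ_three, lieForm2_apply, pd_add, pd_sub, pd_mul, pd10, pd20, pd21]
  ring
theorem lieForm2_d0_d0 (X : Vec) (f g : O) :
    lieForm2 X (d0 f ⨯₃ d0 g) = d0 (lieFun X f) ⨯₃ d0 g + d0 f ⨯₃ d0 (lieFun X g) := by
  ext1 i
  rw [lieForm2_apply]
  fin_cases i <;>
  simp [lieFun, lieForm2, d0, d1, d2, Fin.sum_univ_three, pd_mul, pd_add, pd_sub, cross_apply, pd10, pd20, pd21] <;> ring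
theorem d2_d1 (u : Vec) : d2 (d1 u) = 0 := by
  simp [d1, d2, pd_sub, pd10, pd20, pd21]
theorem d2_d0_cross (f g : O) : d2 (d0 f ⨯₃ d0 g) = 0 := by
  simp [d0, d2, pd_sub, pd_mul, cross_apply, pd10, pd20, pd21]; ring
theorem d2_lieForm2 (X w : Vec) : d2 (lieForm2 X w) = lieFun X (d2 w) + d2 X * d2 w := by
  simp [lieForm2, d1, d2, lieFun, Fin.sum_univ_three, pd_sub, pd_add, pd_mul, cross_apply, pd10, pd20, pd21]; ring

theorem cross0 (a b : Vec) : (a ⨯₃ b) 0 = a 1 * b 2 - a 2 * b 1 := by simp [cross_apply]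
theorem cross1 (a b : Vec) : (a ⨯₃ b) 1 = a 2 * b 0 - a 0 * b 2 := by simp [cross_apply]
theorem cross2 (a b : Vec) : (a ⨯₃ b) 2 = a 0 * b 1 - a 1 * b 0 := by simp [cross_apply]
theorem d1_0 (u : Vec) : d1 u 0 = pd 1 (u 2) - pd 2 (u 1) := rfl
theorem d1_1 (u : Vec) : d1 u 1 = pd 2 (u 0) - pd 0 (u 2) := rfl
theorem d1_2 (u : Vec) : d1 u 2 = pd 0 (u 1) - pd 1 (u 0) := rfl
theorem lieFun_lieFun_comm (X : Vec) (w : Vec) (f : O) :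
    lieFun X (lieFun w f) = lieFun w (lieFun X f) + lieFun (lieForm2 X w) f - d2 X * lieFun w f := by
  have := lieFun_lieVec X w f
  have h : lieFun (lieForm2 X w) f = lieFun (lieVec X w) f + d2 X * lieFun w f := by
    simp only [lieFun, Fin.sum_univ_three, lieForm2_apply, lieVec]; ring
  rw [h, this]; ring
theorem lieFun_fsmul (g : O) (w : Vec) (f : O) : lieFun (g • w) f = g * lieFun w f := by
  simp only [lieFun, Fin.sum_univ_three, Pi.smul_apply, smul_eq_mul]; ring
theorem lieFun_vadd (v w : Vec) (f : O) : lieFun (v + w) f = lieFun v f + lieFun w f := by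
  simp only [lieFun, Fin.sum_univ_three, Pi.add_apply]; ring
theorem lieFun_vsub (v w : Vec) (f : O) : lieFun (v - w) f = lieFun v f - lieFun w f := by
  simp only [lieFun, Fin.sum_univ_three, Pi.sub_apply]; ring
theorem lieFun_vneg (v : Vec) (f : O) : lieFun (-v) f = -lieFun v f := by
  simp only [lieFun, Fin.sum_univ_three, Pi.neg_apply]; ring
theorem lieFun_vsmul (c : ℂ) (v : Vec) (f : O) : lieFun (c • v) f = c • lieFun v f := by
  simp only [lieFun, Fin.sum_univ_three, Pi.smul_apply]; algebra
theorem d2_add (v w : Vec) : d2 (v + w) = d2 v + d2 w := by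
  simp only [d2, Pi.add_apply, pd_add]; ring
theorem d2_sub (v w : Vec) : d2 (v - w) = d2 v - d2 w := by
  simp only [d2, Pi.sub_apply, pd_sub]; ring
theorem d2_neg (v : Vec) : d2 (-v) = -d2 v := by
  simp only [d2, Pi.neg_apply, pd_neg]; ring
theorem d2_smul (c : ℂ) (v : Vec) : d2 (c • v) = c • d2 v := by
  simp only [d2, Pi.smul_apply, pd_smul, smul_add]
theorem d2_fsmul (f : O) (v : Vec) : d2 (f • v) = lieFun v f + f * d2 v := by
  simp only [d2, Pi.smul_apply, smul_eq_mul, pd_mul, lieFun, Fin.sum_univ_three]; ring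
theorem lieForm2_d1_cross (X v w : Vec) : lieForm2 X (d1 (v ⨯₃ w)) =
    d1 (lieForm2 X v ⨯₃ w) + d1 (v ⨯₃ lieForm2 X w) - d1 (d2 X • (v ⨯₃ w)) := by
  ext1 i
  simp only [Pi.add_apply, Pi.sub_apply]
  rw [lieForm2_apply]
  fin_cases i <;>
  simp only [Fin.zero_eta, Fin.mk_one, Fin.reduceFinMk, d1_0, d1_1, d1_2, cross0, cross1, cross2,
    lieForm2_apply, Pi.smul_apply, smul_eq_mul, lieFun, d2,
    Fin.sum_univ_three, pd_add, pd_sub, pd_mul, pd10, pd20, pd21] <;> ring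


theorem dot_d0 (f : O) (w : Vec) : d0 f ⬝ᵥ w = lieFun w f := by
  simp only [dotProduct, d0, lieFun, mul_comm]
theorem d1_add (v w : Vec) : d1 (v + w) = d1 v + d1 w := by
  ext1 i; fin_cases i <;> simp only [Fin.zero_eta, Fin.mk_one, Fin.reduceFinMk, d1_0, d1_1, d1_2, Pi.add_apply, pd_add] <;> ring
theorem d1_sub (v w : Vec) : d1 (v - w) = d1 v - d1 w := by
  ext1 i; fin_cases i <;> simp only [Fin.zero_eta, Fin.mk_one, Fin.reduceFinMk, d1_0, d1_1, d1_2, Pi.sub_apply, pd_sub] <;> ring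
theorem d1_smul (c : ℂ) (v : Vec) : d1 (c • v) = c • d1 v := by
  ext1 i; fin_cases i <;> simp only [Fin.zero_eta, Fin.mk_one, Fin.reduceFinMk, d1_0, d1_1, d1_2, Pi.smul_apply, pd_smul, smul_sub]
theorem d1_fsmul (f : O) (v : Vec) : d1 (f • v) = d0 f ⨯₃ v + f • d1 v := by
  ext1 i; fin_cases i <;> simp only [Fin.zero_eta, Fin.mk_one, Fin.reduceFinMk, d1_0, d1_1, d1_2, Pi.smul_apply, Pi.add_apply, smul_eq_mul, pd_mul, cross0, cross1, cross2, d0] <;> ring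
theorem d1_triple (u v : O) (w : Vec) : d1 ((d0 u ⨯₃ d0 v) ⨯₃ w) =
    d0 (lieFun w u) ⨯₃ d0 v - d0 (lieFun w v) ⨯₃ d0 u := by
  ext1 i; fin_cases i <;> simp only [Fin.zero_eta, Fin.mk_one, Fin.reduceFinMk, d1_0, d1_1, d1_2, Pi.smul_apply, Pi.sub_apply, smul_eq_mul, pd_mul, pd_add, pd_sub, lieFun, Fin.sum_univ_three, cross0, cross1, cross2, d0, pd10, pd20, pd21] <;> ring
theorem d1_triple' (u v : O) (w : Vec) : d1 (w ⨯₃ (d0 u ⨯₃ d0 v)) =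
    d0 (lieFun w v) ⨯₃ d0 u - d0 (lieFun w u) ⨯₃ d0 v := by
  ext1 i; fin_cases i <;> simp only [Fin.zero_eta, Fin.mk_one, Fin.reduceFinMk, d1_0, d1_1, d1_2, Pi.smul_apply, Pi.sub_apply, smul_eq_mul, pd_mul, pd_add, pd_sub, lieFun, Fin.sum_univ_three, cross0, cross1, cross2, d0, pd10, pd20, pd21] <;> ring
theorem lieFun_d0_cross (u v f : O) : lieFun (d0 u ⨯₃ d0 v) f = d0 f 0 * (d0 u 1 * d0 v 2 - d0 u 2 * d0 v 1) + d0 f 1 * (d0 u 2 * d0 v 0 - d0 u 0 * d0 v 2) + d0 f 2 * (d0 u 0 * d0 v 1 - d0 u 1 * d0 v 0) := by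
  simp only [lieFun, Fin.sum_univ_three, cross0, cross1, cross2, d0]; ring

theorem d0_cross_cross (f : O) (v w : Vec) : d0 f ⨯₃ (v ⨯₃ w) = lieFun w f • v - lieFun v f • w := by
  ext1 i; fin_cases i <;> simp only [Fin.zero_eta, Fin.mk_one, Fin.reduceFinMk, cross0, cross1, cross2, Pi.sub_apply, Pi.smul_apply, smul_eq_mul, lieFun, d0, Fin.sum_univ_three] <;> ring
theorem d1_neg (v : Vec) : d1 (-v) = -d1 v := by
  ext1 i; fin_cases i <;> simp only [Fin.zero_eta, Fin.mk_one, Fin.reduceFinMk, d1_0, d1_1, d1_2, Pi.neg_apply, pd_neg] <;> ring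
theorem cross_addl (u v w : Vec) : (u + v) ⨯₃ w = u ⨯₃ w + v ⨯₃ w := LinearMap.map_add₂ _ _ _ _
theorem cross_addr (u v w : Vec) : u ⨯₃ (v + w) = u ⨯₃ v + u ⨯₃ w := map_add _ _ _
theorem cross_subl (u v w : Vec) : (u - v) ⨯₃ w = u ⨯₃ w - v ⨯₃ w := LinearMap.map_sub₂ _ _ _ _
theorem cross_subr (u v w : Vec) : u ⨯₃ (v - w) = u ⨯₃ v - u ⨯₃ w := map_sub _ _ _
theorem cross_negl (u w : Vec) : (-u) ⨯₃ w = -(u ⨯₃ w) := LinearMap.map_neg₂ _ _ _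
theorem cross_negr (u w : Vec) : u ⨯₃ (-w) = -(u ⨯₃ w) := map_neg _ _
theorem cross_fsmull (f : O) (u w : Vec) : (f • u) ⨯₃ w = f • (u ⨯₃ w) := LinearMap.map_smul₂ _ _ _ _
theorem cross_fsmulr (f : O) (u w : Vec) : u ⨯₃ (f • w) = f • (u ⨯₃ w) := map_smul _ _ _
theorem cross_smull (c : ℂ) (u w : Vec) : (c • u) ⨯₃ w = c • (u ⨯₃ w) := by
  ext1 i; fin_cases i <;> simp only [Fin.zero_eta, Fin.mk_one, Fin.reduceFinMk, cross0, cross1, cross2, Pi.smul_apply] <;> algebra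
theorem cross_smulr (c : ℂ) (u w : Vec) : u ⨯₃ (c • w) = c • (u ⨯₃ w) := by
  ext1 i; fin_cases i <;> simp only [Fin.zero_eta, Fin.mk_one, Fin.reduceFinMk, cross0, cross1, cross2, Pi.smul_apply] <;> algebra
theorem cross_zerol (w : Vec) : (0 : Vec) ⨯₃ w = 0 := LinearMap.map_zero₂ _ _
theorem cross_zeror (u : Vec) : u ⨯₃ (0 : Vec) = 0 := map_zero _
theorem d0_zero : d0 0 = 0 := by ext1 i; simp only [d0, map_zero, Pi.zero_apply]
theorem lieFun_apply' (w : Vec) (f : O) : lieFun w f = w 0 * d0 f 0 + w 1 * d0 f 1 + w 2 * d0 f 2 := by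
  simp only [lieFun, d0, Fin.sum_univ_three]

attribute [local irreducible] lieFun d0 d1 d2 lieForm2 lieVec pd

set_option maxHeartbeats 2000000

theorem j0a (X Y Z : Vec) : lieVec X (lieVec Y Z) = lieVec (lieVec X Y) Z + lieVec Y (lieVec X Z) := by
  have e : ∀ (U V : Vec) i, lieVec U V i = lieFun U (V i) - lieFun V (U i) := by
    intro U V i; unfold lieVec; rfl
  ext1 i
  simp only [e, Pi.add_apply, lieFun_lieVec, lieFun_sub]
  ring

theorem j0b (X : Vec) (s : Mat) (Y : Vec) (t : Mat) (Z : Vec) (r : Mat) :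
    eeSl X s (lieVec Y Z) (eeSl Y t Z r) = eeSl (lieVec X Y) (eeSl X s Y t) Z r + eeSl Y t (lieVec X Z) (eeSl X s Z r) := by
  ext i j
  simp only [eeSl, Matrix.add_apply, Matrix.sub_apply, Matrix.map_apply, Matrix.mul_apply, Fin.sum_univ_two,
    lieFun_add, lieFun_sub, lieFun_mul, lieFun_lieVec]
  ring

theorem j0c (X : Vec) (s : Mat) (w : Vec) (Y : Vec) (t : Mat) (v : Vec) (Z : Vec) (r : Mat) (u : Vec) :
    eeForm X s w (lieVec Y Z) (eeSl Y t Z r) (eeForm Y t v Z r u) =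
    eeForm (lieVec X Y) (eeSl X s Y t) (eeForm X s w Y t v) Z r u +
    eeForm Y t v (lieVec X Z) (eeSl X s Z r) (eeForm X s w Z r u) := by
  simp only [eeForm, eeSl, Matrix.add_apply, Matrix.sub_apply, Matrix.map_apply, Matrix.mul_apply, Fin.sum_univ_two,
    lieForm2_add, lieForm2_sub, lieForm2_smul, lieForm2_d0_d0, lieForm2_lieVec, d2_lieVec, d0_add, d0_sub, d0_mul]
  ext1 i
  fin_cases i <;>
  simp only [Fin.zero_eta, Fin.mk_one, Fin.reduceFinMk, Pi.add_apply, Pi.sub_apply, Pi.smul_apply, cross0, cross1, cross2, smul_eq_mul] <;> algebra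

theorem j1a (X : Vec) (s : Mat) (Y : Vec) (t : Mat) (f : Fin 2 → O) :
    eo0 X s (eo0 Y t f) = eo0 (lieVec X Y) (eeSl X s Y t) f + eo0 Y t (eo0 X s f) := by
  ext1 a
  simp only [eo0, eeSl, lieFun_lieVec, d2_lieVec, Fin.sum_univ_two, Pi.add_apply, Matrix.add_apply, Matrix.sub_apply, Matrix.map_apply, Matrix.mul_apply, lieFun_add, lieFun_sub, lieFun_smul, lieFun_mul]
  algebra

theorem j1b (X : Vec) (s : Mat) (w : Vec) (Y : Vec) (t : Mat) (v : Vec) (hs : s 1 1 = - s 0 0) (ht : t 1 1 = - t 0 0)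
   (f : Fin 2 → O) (σ : Fin 2 → Vec) :
    eo2 X s w (eo0 Y t f) (eo2 Y t v f σ) = eo2 (lieVec X Y) (eeSl X s Y t) (eeForm X s w Y t v) f σ + eo2 Y t v (eo0 X s f) (eo2 X s w f σ) := by
  ext1 a
  simp only [eo0, eo2, eeSl, eeForm, d2_lieVec, Fin.sum_univ_two, Pi.add_apply, Matrix.add_apply, Matrix.sub_apply, Matrix.map_apply, Matrix.mul_apply, lieForm2_lieVec, lieForm2_add, lieForm2_fsmul, lieForm2_smul, lieForm2_sub, lieForm2_d0_d0, d0_add, d0_sub, d0_smul, d0_mul]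
  ext1 i
  fin_cases a <;> fin_cases i <;> simp only [Fin.zero_eta, Fin.mk_one, Fin.reduceFinMk, Fin.isValue, Pi.add_apply, Pi.sub_apply, Pi.smul_apply, Pi.neg_apply, cross0, cross1, cross2, smul_eq_mul, hs, ht, d0_neg] <;> algebra


theorem ooSl_00 (f : Fin 2 → O) (σ : Fin 2 → Vec) (g : Fin 2 → O) (τ : Fin 2 → Vec) :
    ooSl f σ g τ 0 0 = (1 / 2 : ℂ) • (ooK (f 0) (τ 1) + ooK (g 1) (σ 0) + (ooK (f 1) (τ 0) + ooK (g 0) (σ 1))) := rfl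
theorem ooSl_11 (f : Fin 2 → O) (σ : Fin 2 → Vec) (g : Fin 2 → O) (τ : Fin 2 → Vec) :
    ooSl f σ g τ 1 1 = -(1 / 2 : ℂ) • (ooK (f 0) (τ 1) + ooK (g 1) (σ 0) + (ooK (f 1) (τ 0) + ooK (g 0) (σ 1))) := rfl
theorem ooSl_01 (f : Fin 2 → O) (σ : Fin 2 → Vec) (g : Fin 2 → O) (τ : Fin 2 → Vec) :
    ooSl f σ g τ 0 1 = -(ooK (f 0) (τ 0) + ooK (g 0) (σ 0)) := rfl
theorem ooSl_10 (f : Fin 2 → O) (σ : Fin 2 → Vec) (g : Fin 2 → O) (τ : Fin 2 → Vec) :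
    ooSl f σ g τ 1 0 = (ooK (f 1) (τ 1) + ooK (g 1) (σ 1)) := rfl
theorem j2a (X : Vec) (s : Mat) (w : Vec) (hs : s 1 1 = - s 0 0) (f g : Fin 2 → O) (σ τ : Fin 2 → Vec) :
    lieVec X (ooVec f σ g τ) = ooVec (eo0 X s f) (eo2 X s w f σ) g τ + ooVec f σ (eo0 X s g) (eo2 X s w g τ) := by
  have e : ∀ (V : Vec), lieVec X V = lieForm2 X V - d2 X • V := by
    intro V; ext1 i; rw [Pi.sub_apply, lieForm2_apply]; unfold lieVec; simp
  simp only [e, ooVec, eo0, eo2, Fin.sum_univ_two, lieForm2_add, lieForm2_fsmul, lieForm2_smul, lieForm2_sub, lieForm2_neg, lieForm2_d0_d0, d0_add, d0_sub, d0_smul, d0_mul]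
  ext1 i
  fin_cases i <;> simp only [Fin.zero_eta, Fin.mk_one, Fin.reduceFinMk, Fin.isValue, Pi.add_apply, Pi.sub_apply, Pi.smul_apply, Pi.neg_apply, cross0, cross1, cross2, smul_eq_mul, hs, d0_neg] <;> algebra

theorem j2b (X : Vec) (s : Mat) (w : Vec) (hw : d2 w = 0) (hs : s 1 1 = - s 0 0) (f g : Fin 2 → O) (σ τ : Fin 2 → Vec) :
    eeSl X s (ooVec f σ g τ) (ooSl f σ g τ) = ooSl (eo0 X s f) (eo2 X s w f σ) g τ + ooSl f σ (eo0 X s g) (eo2 X s w g τ) := by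
  refine Matrix.ext fun i j => ?_
  simp only [eeSl, Matrix.add_apply, Matrix.sub_apply, Matrix.map_apply, Matrix.mul_apply, Fin.sum_univ_two]
  fin_cases i <;> fin_cases j <;>
  simp only [Fin.zero_eta, Fin.mk_one, Fin.isValue, ooSl_00, ooSl_01, ooSl_10, ooSl_11, ooK, dot_d0] <;>
  simp only [Fin.isValue, ooVec, eo0, eo2, Fin.sum_univ_two, hs, d0_neg, cross_negl, lieFun_add, lieFun_sub, lieFun_neg, lieFun_smul, lieFun_mul, lieFun_vadd, lieFun_vsub, lieFun_vneg, lieFun_vsmul, lieFun_fsmul, lieFun_lieFun_comm X, d2_add, d2_sub, d2_smul, d2_fsmul, d2_neg, d2_lieForm2, d2_d0_cross, hw, hs, lieFun_d0_cross, d0_add, d0_sub, d0_smul, d0_mul, d0_neg, Pi.add_apply, Pi.sub_apply, Pi.smul_apply, Pi.neg_apply, smul_eq_mul] <;>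
  algebra

theorem j2c (X : Vec) (s : Mat) (w : Vec) (hw : d2 w = 0) (hs : s 1 1 = - s 0 0) (f g : Fin 2 → O) (σ τ : Fin 2 → Vec) :
    eeForm X s w (ooVec f σ g τ) (ooSl f σ g τ) (ooForm f σ g τ) = ooForm (eo0 X s f) (eo2 X s w f σ) g τ + ooForm f σ (eo0 X s g) (eo2 X s w g τ) := by
  have e : ∀ (V : Vec), lieForm2 V w = d1 (w ⨯₃ V) := by
    intro V; unfold lieForm2; rw [hw]; simp
  have c : ∀ a, σ a ⨯₃ w = -(w ⨯₃ σ a) := fun a => (cross_anticomm _ _).symm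
  simp only [eeForm, Fin.sum_univ_two, ooSl_00, ooSl_01, ooSl_10, ooSl_11, ooK, dot_d0, e]
  simp only [hs, ooVec, ooForm, eo0, eo2, Fin.sum_univ_two,
   cross_addl, cross_addr, cross_subl, cross_subr, cross_negl, cross_negr, cross_fsmull, cross_fsmulr, cross_smull, cross_smulr, cross_zerol, cross_zeror, 
   lieForm2_add, lieForm2_sub, lieForm2_neg, lieForm2_d0_d0, lieForm2_d1_cross, d1_add, d1_sub, d1_smul, d1_fsmul, d1_triple, d1_triple', d1_neg, d0_cross_cross, c, d0_zero,
   lieFun_add, lieFun_sub, lieFun_neg, lieFun_smul, lieFun_mul, lieFun_vadd, lieFun_vsub, lieFun_vneg, lieFun_vsmul, lieFun_fsmul, lieFun_lieFun_comm X, d2_add, d2_sub, d2_smul, d2_fsmul, d2_neg, d2_lieForm2, d2_d0_cross, hw, hs, d0_add, d0_sub, d0_smul, d0_mul, d0_neg]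
  ext1 i
  fin_cases i <;>
  simp only [Fin.zero_eta, Fin.mk_one, Fin.reduceFinMk, Fin.isValue, cross0, cross1, cross2, Pi.add_apply, Pi.sub_apply, Pi.smul_apply, Pi.neg_apply, Pi.zero_apply, smul_eq_mul] <;>
  algebra

theorem j3a (f g h : Fin 2 → O) (σ τ υ : Fin 2 → Vec) :
    eo0 (ooVec f σ g τ) (ooSl f σ g τ) h + eo0 (ooVec g τ h υ) (ooSl g τ h υ) f + eo0 (ooVec h υ f σ) (ooSl h υ f σ) g = 0 := by
  ext1 a
  simp only [Pi.add_apply, Pi.zero_apply, eo0, Fin.sum_univ_two, ooVec, lieFun_vadd, lieFun_vsub, lieFun_vneg, lieFun_fsmul, d2_sub, d2_fsmul, d2_neg, d2_d0_cross, lieFun_d0_cross]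
  fin_cases a <;>
  simp only [Fin.zero_eta, Fin.mk_one, Fin.isValue, ooSl_00, ooSl_01, ooSl_10, ooSl_11, ooK, dot_d0] <;> algebra

theorem j3b (f g h : Fin 2 → O) (σ τ υ : Fin 2 → Vec) :
    eo2 (ooVec f σ g τ) (ooSl f σ g τ) (ooForm f σ g τ) h υ + eo2 (ooVec g τ h υ) (ooSl g τ h υ) (ooForm g τ h υ) f σ + eo2 (ooVec h υ f σ) (ooSl h υ f σ) (ooForm h υ f σ) g τ = 0 := by
  have e : ∀ X w : Vec, lieForm2 X w = d1 (w ⨯₃ X) + d2 w • X := by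
    intro X w; unfold lieForm2; rfl
  have c10 : ∀ u v : Fin 2 → Vec, u 1 ⨯₃ v 0 = - (v 0 ⨯₃ u 1) := fun u v => (cross_anticomm _ _).symm
  have c1 : τ 0 ⨯₃ σ 0 = -(σ 0 ⨯₃ τ 0) := (cross_anticomm _ _).symm
  have c2 : υ 0 ⨯₃ σ 0 = -(σ 0 ⨯₃ υ 0) := (cross_anticomm _ _).symm
  have c3 : υ 0 ⨯₃ τ 0 = -(τ 0 ⨯₃ υ 0) := (cross_anticomm _ _).symm
  have c4 : τ 1 ⨯₃ σ 1 = -(σ 1 ⨯₃ τ 1) := (cross_anticomm _ _).symm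
  have c5 : υ 1 ⨯₃ σ 1 = -(σ 1 ⨯₃ υ 1) := (cross_anticomm _ _).symm
  have c6 : υ 1 ⨯₃ τ 1 = -(τ 1 ⨯₃ υ 1) := (cross_anticomm _ _).symm
  ext1 a
  simp only [Pi.add_apply, Pi.zero_apply, eo2, Fin.sum_univ_two]
  fin_cases a <;>
  simp only [Fin.zero_eta, Fin.mk_one, Fin.isValue, ooSl_00, ooSl_01, ooSl_10, ooSl_11, ooK, dot_d0, e]
  all_goals
  simp only [ooVec, ooForm, cross_addl, cross_addr, cross_subl, cross_subr, cross_negl, cross_negr, cross_fsmull, cross_fsmulr, cross_smull, cross_smulr, cross_zerol, cross_zeror, d1_add, d1_sub, d1_neg, d1_fsmul, d1_triple', d0_cross_cross, c10, c1, c2, c3, c4, c5, c6, d2_sub, d2_fsmul, d2_neg, d2_d0_cross,d0_add, d0_sub, d0_smul, d0_mul, d0_neg]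
  all_goals
    ext1 i
    fin_cases i <;>
    simp only [Fin.zero_eta, Fin.mk_one, Fin.reduceFinMk, Fin.isValue, Pi.zero_apply, cross0, cross1, cross2, Pi.add_apply, Pi.sub_apply, Pi.smul_apply, Pi.neg_apply, smul_eq_mul] <;>
    algebra
/-! ### The Lie superalgebra `E(3,8)` -/

/-- The space `Ω²_cl(3)` of closed 2-forms, which is `dΩ¹(3)`. -/
def ClosedForm : Submodule ℂ Vec where
  carrier := {w | d2 w = 0}
  add_mem' {v w} hv hw := by
    simp only [Set.mem_ofPred_eq] at hv hw ⊢
    rw [d2_add, hv, hw, add_zero]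
  zero_mem' := by
    have h := d2_smul 0 0
    rwa [zero_smul, zero_smul] at h
  smul_mem' c w hw := by
    simp only [Set.mem_ofPred_eq] at hw ⊢
    rw [d2_smul, hw, smul_zero]

/-- The Lie algebra `sl₂(Ω⁰(3))`. -/
abbrev SlO : Type := LieAlgebra.SpecialLinear.sl (Fin 2) O

theorem slO_trace (s : SlO) : s.1 1 1 = -s.1 0 0 := by
  have h : Matrix.trace s.1 = 0 := s.2
  rw [Matrix.trace_fin_two] at h
  linear_combination h

theorem slO_mem (A : Mat) (h : A 0 0 + A 1 1 = 0) : A ∈ LieAlgebra.SpecialLinear.sl (Fin 2) O := by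
  change Matrix.trace A = 0
  rw [Matrix.trace_fin_two, h]

/-- The even part of `E(3,8)`: `W₃ + sl₂(Ω⁰(3)) + Ω²_cl(3)`. -/
def Even : Type := Vec × SlO × ClosedForm

instance : AddCommGroup Even := inferInstanceAs (AddCommGroup (Vec × SlO × ClosedForm))

instance : Module ℂ Even := inferInstanceAs (Module ℂ (Vec × SlO × ClosedForm))

/-- The odd part of `E(3,8)`: `Ω⁰(3)^{-1/2} ⊗ ℂ² + Ω²(3)^{-1/2} ⊗ ℂ²`. -/
def Odd : Type := (Fin 2 → O) × (Fin 2 → Vec)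

instance : AddCommGroup Odd := inferInstanceAs (AddCommGroup ((Fin 2 → O) × (Fin 2 → Vec)))

instance : Module ℂ Odd := inferInstanceAs (Module ℂ ((Fin 2 → O) × (Fin 2 → Vec)))

/-- The vector field component of an even element. -/
def Even.vec (x : Even) : Vec := x.1

/-- The `sl₂(Ω⁰(3))`-component of an even element, as a matrix. -/
def Even.mat (x : Even) : Mat := x.2.1.1

/-- The closed 2-form component of an even element. -/
def Even.form (x : Even) : Vec := x.2.2.1

/-- The function component of an odd element. -/
def Odd.fn (a : Odd) : Fin 2 → O := a.1

/-- The 2-form component of an odd element. -/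
def Odd.form (a : Odd) : Fin 2 → Vec := a.2

theorem Even.ext {x y : Even} (h1 : x.vec = y.vec) (h2 : x.mat = y.mat) (h3 : x.form = y.form) :
    x = y :=
  Prod.ext h1 (Prod.ext (Subtype.ext h2) (Subtype.ext h3))

theorem Odd.ext {a b : Odd} (h1 : a.fn = b.fn) (h2 : a.form = b.form) : a = b :=
  Prod.ext h1 h2

theorem vec_add (x y : Even) : (x + y).vec = x.vec + y.vec := rfl
theorem mat_add (x y : Even) : (x + y).mat = x.mat + y.mat := rfl
theorem form_add (x y : Even) : (x + y).form = x.form + y.form := rfl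
theorem vec_smul (c : ℂ) (x : Even) : (c • x).vec = c • x.vec := rfl
theorem mat_smul (c : ℂ) (x : Even) : (c • x).mat = c • x.mat := rfl
theorem form_smul (c : ℂ) (x : Even) : (c • x).form = c • x.form := rfl
theorem ofn_add (x y : Odd) : (x + y).fn = x.fn + y.fn := rfl
theorem oform_add (x y : Odd) : (x + y).form = x.form + y.form := rfl
theorem ofn_smul (c : ℂ) (x : Odd) : (c • x).fn = c • x.fn := rfl
theorem oform_smul (c : ℂ) (x : Odd) : (c • x).form = c • x.form := rfl
theorem mat_trace (x : Even) : x.mat 1 1 = -x.mat 0 0 := slO_trace x.2.1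
theorem form_closed (x : Even) : d2 x.form = 0 := x.2.2.2

instance : Bracket Even Even where
  bracket x y :=
    (lieVec x.vec y.vec,
      ⟨eeSl x.vec x.mat y.vec y.mat, by
        apply slO_mem
        simp only [eeSl, Matrix.add_apply, Matrix.sub_apply, Matrix.map_apply, Matrix.mul_apply,
          Fin.sum_univ_two, mat_trace, lieFun_neg]
        ring⟩,
      ⟨eeForm x.vec x.mat x.form y.vec y.mat y.form, by
        change d2 _ = 0
        simp only [eeForm, Fin.sum_univ_two, d2_add, d2_sub, d2_smul, d2_lieForm2, d2_d0_cross,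
          form_closed]
        have h : ∀ X : Vec, lieFun X 0 = 0 := fun X => by
          have h := lieFun_smul X 0 0
          rwa [zero_smul, zero_smul] at h
        simp only [h]
        simp⟩)

instance : Bracket Even Odd where
  bracket x a := (eo0 x.vec x.mat a.fn, eo2 x.vec x.mat x.form a.fn a.form)

theorem vec_lie (x y : Even) : ⁅x, y⁆.vec = lieVec x.vec y.vec := rfl
theorem mat_lie (x y : Even) : ⁅x, y⁆.mat = eeSl x.vec x.mat y.vec y.mat := rfl
theorem form_lie (x y : Even) :
    ⁅x, y⁆.form = eeForm x.vec x.mat x.form y.vec y.mat y.form := rfl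
theorem ofn_lie (x : Even) (a : Odd) : ⁅x, a⁆.fn = eo0 x.vec x.mat a.fn := rfl
theorem oform_lie (x : Even) (a : Odd) :
    ⁅x, a⁆.form = eo2 x.vec x.mat x.form a.fn a.form := rfl

theorem lieVec_apply (X Y : Vec) (i : Fin 3) :
    lieVec X Y i = lieFun X (Y i) - lieFun Y (X i) := by
  unfold lieVec; rfl

instance : LieRing Even where
  add_lie x y z := by
    apply Even.ext
    · ext1 i
      simp only [vec_lie, vec_add, lieVec_apply, Pi.add_apply, lieFun_add, lieFun_vadd]
      ring
    · refine Matrix.ext fun i j => ?_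
      simp only [mat_lie, vec_add, mat_add, eeSl, Matrix.add_apply, Matrix.sub_apply,
        Matrix.map_apply, Matrix.mul_apply, Fin.sum_univ_two, lieFun_add, lieFun_vadd]
      ring
    · ext1 i
      simp only [form_lie, vec_add, mat_add, form_add, eeForm, Matrix.add_apply, Fin.sum_univ_two,
        lieForm2_apply, Pi.add_apply, Pi.sub_apply, Pi.smul_apply, d2_add, d0_add, cross_addl,
        lieFun_add, lieFun_vadd]
      algebra
  lie_add x y z := by
    apply Even.ext
    · ext1 i
      simp only [vec_lie, vec_add, lieVec_apply, Pi.add_apply, lieFun_add, lieFun_vadd]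
      ring
    · refine Matrix.ext fun i j => ?_
      simp only [mat_lie, vec_add, mat_add, eeSl, Matrix.add_apply, Matrix.sub_apply,
        Matrix.map_apply, Matrix.mul_apply, Fin.sum_univ_two, lieFun_add, lieFun_vadd]
      ring
    · ext1 i
      simp only [form_lie, vec_add, mat_add, form_add, eeForm, Matrix.add_apply, Fin.sum_univ_two,
        lieForm2_apply, Pi.add_apply, Pi.sub_apply, Pi.smul_apply, d2_add, d0_add, cross_addr,
        lieFun_add, lieFun_vadd]
      algebra
  lie_self x := by
    apply Even.ext
    · ext1 i
      exact (lieVec_apply _ _ i).trans (sub_self _)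
    · refine Matrix.ext fun i j => ?_
      change eeSl x.vec x.mat x.vec x.mat i j = 0
      simp only [eeSl, sub_self, add_zero, Matrix.zero_apply]
    · change eeForm x.vec x.mat x.form x.vec x.mat x.form = 0
      have h : d0 (x.mat 1 0) ⨯₃ d0 (x.mat 0 1) = -(d0 (x.mat 0 1) ⨯₃ d0 (x.mat 1 0)) :=
        (cross_anticomm _ _).symm
      simp only [eeForm, Fin.sum_univ_two, cross_self, sub_self, smul_zero, h, zero_add, add_zero,
        add_neg_cancel]
  leibniz_lie x y z := by
    apply Even.ext
    · exact j0a _ _ _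
    · exact j0b _ _ _ _ _ _
    · exact j0c _ _ _ _ _ _ _ _ _

instance : LieAlgebra ℂ Even where
  lie_smul c x y := by
    apply Even.ext
    · ext1 i
      simp only [vec_lie, vec_smul, lieVec_apply, Pi.smul_apply, lieFun_smul, lieFun_vsmul,
        smul_sub]
    · refine Matrix.ext fun i j => ?_
      simp only [mat_lie, vec_smul, mat_smul, eeSl, Matrix.add_apply, Matrix.sub_apply,
        Matrix.smul_apply, Matrix.map_apply, Matrix.mul_apply, Fin.sum_univ_two, lieFun_smul,
        lieFun_vsmul]
      algebra
    · ext1 i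
      simp only [form_lie, vec_smul, mat_smul, form_smul, eeForm, Matrix.smul_apply,
        Fin.sum_univ_two, lieForm2_apply, Pi.add_apply, Pi.sub_apply, Pi.smul_apply, d2_smul,
        d0_smul, cross_smulr, lieFun_smul, lieFun_vsmul]
      algebra

instance : LieRingModule Even Odd where
  add_lie x y a := by
    apply Odd.ext
    · ext1 i
      simp only [ofn_lie, ofn_add, vec_add, mat_add, eo0, Fin.sum_univ_two, Pi.add_apply,
        Matrix.add_apply, lieFun_vadd, d2_add]
      algebra
    · refine funext fun i => funext fun j => ?_
      simp only [oform_lie, oform_add, vec_add, mat_add, form_add, eo2, Fin.sum_univ_two,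
        Pi.add_apply, Pi.sub_apply, Pi.smul_apply, Matrix.add_apply, lieForm2_apply, lieFun_vadd,
        lieFun_add, d2_add, d0_add, cross_addl, smul_eq_mul]
      algebra
  lie_add x a b := by
    apply Odd.ext
    · ext1 i
      simp only [ofn_lie, ofn_add, eo0, Fin.sum_univ_two, Pi.add_apply, lieFun_add]
      algebra
    · refine funext fun i => funext fun j => ?_
      simp only [oform_lie, oform_add, ofn_add, eo2, Fin.sum_univ_two,
        Pi.add_apply, Pi.sub_apply, Pi.smul_apply, lieForm2_apply, lieFun_vadd,
        lieFun_add, d0_add, cross_addr, smul_eq_mul]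
      algebra
  leibniz_lie x y a := by
    apply Odd.ext
    · exact j1a _ _ _ _ _
    · exact j1b _ _ _ _ _ _ (mat_trace x) (mat_trace y) _ _

instance : LieModule ℂ Even Odd where
  smul_lie c x a := by
    apply Odd.ext
    · ext1 i
      simp only [ofn_lie, ofn_smul, vec_smul, mat_smul, eo0, Fin.sum_univ_two, Pi.smul_apply,
        Matrix.smul_apply, lieFun_vsmul, d2_smul]
      algebra
    · refine funext fun i => funext fun j => ?_
      simp only [oform_lie, oform_smul, vec_smul, mat_smul, form_smul, eo2, Fin.sum_univ_two,
        Pi.add_apply, Pi.sub_apply, Pi.smul_apply, Matrix.smul_apply, lieForm2_apply, lieFun_vsmul,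
        lieFun_smul, d2_smul, d0_smul, cross_smull, smul_eq_mul]
      algebra
  lie_smul c x a := by
    apply Odd.ext
    · ext1 i
      simp only [ofn_lie, ofn_smul, eo0, Fin.sum_univ_two, Pi.smul_apply, lieFun_smul]
      algebra
    · refine funext fun i => funext fun j => ?_
      simp only [oform_lie, oform_smul, ofn_smul, eo2, Fin.sum_univ_two,
        Pi.add_apply, Pi.sub_apply, Pi.smul_apply, lieForm2_apply, lieFun_vsmul,
        lieFun_smul, d0_smul, cross_smulr, smul_eq_mul]
      algebra

/-- The bracket of two odd elements. -/
def oddBr (a b : Odd) : Even :=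
  (ooVec a.fn a.form b.fn b.form,
    ⟨ooSl a.fn a.form b.fn b.form, by
      apply slO_mem
      rw [ooSl_00, ooSl_11]
      algebra⟩,
    ⟨ooForm a.fn a.form b.fn b.form, by
      change d2 _ = 0
      simp only [ooForm, d2_sub, d2_d1, d2_d0_cross, sub_self]⟩)

theorem vec_oddBr (a b : Odd) : (oddBr a b).vec = ooVec a.fn a.form b.fn b.form := rfl
theorem mat_oddBr (a b : Odd) : (oddBr a b).mat = ooSl a.fn a.form b.fn b.form := rfl
theorem form_oddBr (a b : Odd) : (oddBr a b).form = ooForm a.fn a.form b.fn b.form := rfl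

theorem oddBr_symm (a b : Odd) : oddBr a b = oddBr b a := by
  have h : ∀ u v : Vec, v ⨯₃ u = -(u ⨯₃ v) := fun u v => (cross_anticomm u v).symm
  apply Even.ext
  · simp only [vec_oddBr, ooVec, h (d0 (a.fn 0)), h (d0 (a.fn 1))]
    ext1 i
    simp only [Pi.add_apply, Pi.sub_apply, Pi.neg_apply, Pi.smul_apply, smul_eq_mul]
    algebra
  · refine Matrix.ext fun i j => ?_
    fin_cases i <;> fin_cases j <;>
    simp only [mat_oddBr, Fin.zero_eta, Fin.mk_one, Fin.isValue, ooSl_00, ooSl_01, ooSl_10,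
      ooSl_11] <;> algebra
  · simp only [form_oddBr, ooForm, h (a.form 0), h (a.form 1), d1_sub, d1_neg]
    ext1 i
    simp only [Pi.add_apply, Pi.sub_apply, Pi.neg_apply, Pi.smul_apply, smul_eq_mul]
    algebra

theorem oddBr_add (a b c : Odd) : oddBr a (b + c) = oddBr a b + oddBr a c := by
  apply Even.ext
  · simp only [vec_oddBr, vec_add, ofn_add, oform_add, ooVec, Pi.add_apply, d0_add, cross_addr]
    ext1 i
    simp only [Pi.add_apply, Pi.sub_apply, Pi.neg_apply, Pi.smul_apply, smul_eq_mul]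
    algebra
  · refine Matrix.ext fun i j => ?_
    fin_cases i <;> fin_cases j <;>
    simp only [mat_oddBr, mat_add, ofn_add, oform_add, Matrix.add_apply, Pi.add_apply,
      Fin.zero_eta, Fin.mk_one, Fin.isValue, ooSl_00, ooSl_01, ooSl_10, ooSl_11, ooK, dot_d0,
      lieFun_add, lieFun_vadd, d2_add] <;> algebra
  · simp only [form_oddBr, form_add, ofn_add, oform_add, ooForm, Pi.add_apply, d1_sub, d1_add,
      d0_add, d2_add, cross_addr, cross_addl]
    ext1 i
    simp only [Pi.add_apply, Pi.sub_apply, Pi.neg_apply, Pi.smul_apply, smul_eq_mul]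
    algebra

theorem oddBr_smul (c : ℂ) (a b : Odd) : oddBr a (c • b) = c • oddBr a b := by
  apply Even.ext
  · simp only [vec_oddBr, vec_smul, ofn_smul, oform_smul, ooVec, Pi.smul_apply, d0_smul,
      cross_smulr]
    ext1 i
    simp only [Pi.add_apply, Pi.sub_apply, Pi.neg_apply, Pi.smul_apply, smul_eq_mul]
    algebra
  · refine Matrix.ext fun i j => ?_
    fin_cases i <;> fin_cases j <;>
    simp only [mat_oddBr, mat_smul, ofn_smul, oform_smul, Matrix.smul_apply, Pi.smul_apply,
      Fin.zero_eta, Fin.mk_one, Fin.isValue, ooSl_00, ooSl_01, ooSl_10, ooSl_11, ooK, dot_d0,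
      lieFun_smul, lieFun_vsmul, d2_smul] <;> algebra
  · simp only [form_oddBr, form_smul, ofn_smul, oform_smul, ooForm, Pi.smul_apply, d1_sub, d1_smul,
      d0_smul, d2_smul, cross_smulr, cross_smull]
    ext1 i
    simp only [Pi.add_apply, Pi.sub_apply, Pi.neg_apply, Pi.smul_apply, smul_eq_mul]
    algebra

/-- The Lie superalgebra `E(3,8)`. -/
instance : LieSuperalgebra Even Odd where
  oddBracket := LinearMap.mk₂ ℂ oddBr
    (fun a b c => by rw [oddBr_symm, oddBr_add, oddBr_symm c a, oddBr_symm c b])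
    (fun r a b => by rw [oddBr_symm, oddBr_smul, oddBr_symm b a])
    oddBr_add (fun r a b => oddBr_smul r a b)
  oddBracket_symm := oddBr_symm
  lie_oddBracket x a b := by
    apply Even.ext
    · exact j2a _ _ x.form (mat_trace x) _ _ _ _
    · exact j2b _ _ _ (form_closed x) (mat_trace x) _ _ _ _
    · exact j2c _ _ _ (form_closed x) (mat_trace x) _ _ _ _
  jacobi_odd a b c := by
    apply Odd.ext
    · exact j3a _ _ _ _ _ _
    · exact j3b _ _ _ _ _ _

end Jacobi


/-! ### The `ℤ`-grading -/

/-- The elements of `E(3,8)₀` all of whose homogeneous components have degree at least `j`, for the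
`ℤ`-grading with `deg xᵢ = -deg ∂ᵢ = deg dxᵢ = 2`, `deg sl₂(ℂ) = 0`. -/
def evenDegGE (j : ℤ) : Submodule ℂ Even where
  carrier := {x | ∀ n : Fin 3 →₀ ℕ,
    (2 * (n.degree : ℤ) - 2 < j → ∀ i, MvPowerSeries.coeff n (x.vec i) = 0) ∧
    (2 * (n.degree : ℤ) < j → ∀ a b, MvPowerSeries.coeff n (x.mat a b) = 0) ∧
    (2 * (n.degree : ℤ) + 4 < j → ∀ i, MvPowerSeries.coeff n (x.form i) = 0)}
  add_mem' {x y} hx hy n := by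
    refine ⟨fun h i => ?_, fun h a b => ?_, fun h i => ?_⟩
    · rw [vec_add, Pi.add_apply, map_add, (hx n).1 h i, (hy n).1 h i, add_zero]
    · rw [mat_add, Matrix.add_apply, map_add, (hx n).2.1 h a b, (hy n).2.1 h a b, add_zero]
    · rw [form_add, Pi.add_apply, map_add, (hx n).2.2 h i, (hy n).2.2 h i, add_zero]
  zero_mem' n := ⟨fun _ _ => map_zero _, fun _ _ _ => map_zero _, fun _ _ => map_zero _⟩
  smul_mem' c x hx n := by
    refine ⟨fun h i => ?_, fun h a b => ?_, fun h i => ?_⟩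
    · rw [vec_smul, Pi.smul_apply, map_smul, (hx n).1 h i, smul_zero]
    · rw [mat_smul, Matrix.smul_apply, map_smul, (hx n).2.1 h a b, smul_zero]
    · rw [form_smul, Pi.smul_apply, map_smul, (hx n).2.2 h i, smul_zero]

/-- The elements of `E(3,8)₁` all of whose homogeneous components have degree at least `j`, for the
`ℤ`-grading with `deg xᵢ = deg dxᵢ = 2`, `deg ε⁺ = deg ε⁻ = -3`. -/
def oddDegGE (j : ℤ) : Submodule ℂ Odd where
  carrier := {x | ∀ n : Fin 3 →₀ ℕ,
    (2 * (n.degree : ℤ) - 3 < j → ∀ a, MvPowerSeries.coeff n (x.fn a) = 0) ∧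
    (2 * (n.degree : ℤ) + 4 - 3 < j → ∀ a i, MvPowerSeries.coeff n (x.form a i) = 0)}
  add_mem' {x y} hx hy n := by
    refine ⟨fun h i => ?_, fun h a b => ?_⟩
    · rw [ofn_add, Pi.add_apply, map_add, (hx n).1 h i, (hy n).1 h i, add_zero]
    · rw [oform_add, Pi.add_apply, Pi.add_apply, map_add, (hx n).2 h a b, (hy n).2 h a b, add_zero]
  zero_mem' n := ⟨fun _ _ => map_zero _, fun _ _ _ => map_zero _⟩
  smul_mem' c x hx n := by
    refine ⟨fun h i => ?_, fun h a b => ?_⟩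
    · rw [ofn_smul, Pi.smul_apply, map_smul, (hx n).1 h i, smul_zero]
    · rw [oform_smul, Pi.smul_apply, Pi.smul_apply, map_smul, (hx n).2 h a b, smul_zero]

/-- The degree zero part `𝔤₀ = gl₃(ℂ) ⊕ sl₂(ℂ) = sl₃(ℂ) ⊕ sl₂(ℂ) ⊕ ℂ Y` of `E(3,8)`.  The matrix
`A` stands for the vector field `∑ A i j xᵢ ∂ⱼ`. -/
abbrev G0 : Type := Matrix (Fin 3) (Fin 3) ℂ × LieAlgebra.SpecialLinear.sl (Fin 2) ℂ

/-- The component of degree zero of an even element. -/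
def proj : Even →ₗ[ℂ] G0 where
  toFun x := (Matrix.of fun i j => MvPowerSeries.coeff (Finsupp.single i 1) (x.vec j),
    ⟨x.mat.map (MvPowerSeries.constantCoeff (σ := Fin 3) (R := ℂ)), by
      change Matrix.trace (x.mat.map (MvPowerSeries.constantCoeff (σ := Fin 3) (R := ℂ))) = 0
      rw [Matrix.trace_fin_two, Matrix.map_apply, Matrix.map_apply, mat_trace, map_neg,
        add_neg_cancel]⟩)
  map_add' x y := by
    refine Prod.ext (Matrix.ext fun i j => ?_) (Subtype.ext (Matrix.ext fun i j => ?_))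
    · exact map_add (MvPowerSeries.coeff (Finsupp.single i 1)) (x.vec j) (y.vec j)
    · exact map_add (MvPowerSeries.constantCoeff (σ := Fin 3) (R := ℂ)) (x.mat i j) (y.mat i j)
  map_smul' c x := by
    refine Prod.ext (Matrix.ext fun i j => ?_) (Subtype.ext (Matrix.ext fun i j => ?_))
    · exact MvPowerSeries.coeff_smul (x.vec j) (Finsupp.single i 1) c
    · exact MvPowerSeries.coeff_smul (x.mat i j) 0 c

/-! ### The four Fock modules -/

/-- The four choices of a Lagrangian subspace of the symplectic space with basis
`xᵢ, z₊, z₋, ∂ᵢ, ∂₊, ∂₋`: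
`L_A = ⟨xᵢ, zₐ⟩`, `L_B = ⟨xᵢ, ∂ₐ⟩`, `L_C = ⟨∂ᵢ, zₐ⟩`, `L_D = ⟨∂ᵢ, ∂ₐ⟩`. -/
inductive Quadrant
  | A
  | B
  | C
  | D

/-- The index set of the variables: `inl i` for `xᵢ` or `∂ᵢ`, and `inr a` for `zₐ` or `∂ₐ`, where
`a = 0` stands for `+` and `a = 1` stands for `-`. -/
abbrev Var : Type := Fin 3 ⊕ Fin 2

/-- The space `V_X = H / (L'_X) = S(L_X) 1_X`, as a space of polynomials; which elements of `L_X`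
the variables stand for depends on `X`. -/
abbrev V : Type := MvPolynomial Var ℂ

/-- Whether the `k`-th variable of `S(L_X)` is `xᵢ` or `zₐ` (true), or is `∂ᵢ` or `∂ₐ` (false). -/
def Quadrant.pos : Quadrant → Var → Bool
  | .A, _ => true
  | .B, .inl _ => true
  | .B, .inr _ => false
  | .C, .inl _ => false
  | .C, .inr _ => true
  | .D, _ => false

/-- The operator `xᵢ` or `zₐ` on `V_X`: multiplication by the variable if it lies in `L_X`, and
minus the derivative along the dual variable `∂ᵢ` or `∂ₐ` otherwise. -/
def posOp (X : Quadrant) (k : Var) : Module.End ℂ V :=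
  if X.pos k then LinearMap.mulLeft ℂ (MvPolynomial.X k)
  else -(MvPolynomial.pderiv k).toLinearMap

/-- The operator `∂ᵢ` or `∂ₐ` on `V_X`: multiplication by the variable if it lies in `L_X`, and
the derivative along the dual variable `xᵢ` or `zₐ` otherwise. -/
def derOp (X : Quadrant) (k : Var) : Module.End ℂ V :=
  if X.pos k then (MvPolynomial.pderiv k).toLinearMap
  else LinearMap.mulLeft ℂ (MvPolynomial.X k)

theorem pderiv_comm (k l : Var) (f : V) :
    MvPolynomial.pderiv k (MvPolynomial.pderiv l f) =
      MvPolynomial.pderiv l (MvPolynomial.pderiv k f) := by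
  have h : ⁅MvPolynomial.pderiv (R := ℂ) k, MvPolynomial.pderiv (R := ℂ) l⁆ = 0 := by
    refine MvPolynomial.derivation_ext fun i => ?_
    rw [Derivation.commutator_apply, MvPolynomial.pderiv_X, MvPolynomial.pderiv_X]
    simp only [Pi.single_apply]
    split_ifs <;> simp
  have h2 := DFunLike.congr_fun h f
  rw [Derivation.commutator_apply] at h2
  exact sub_eq_zero.1 h2

theorem derOp_posOp (X : Quadrant) (k l : Var) :
    derOp X k * posOp X l = posOp X l * derOp X k + if k = l then 1 else 0 := by
  refine LinearMap.ext fun f => ?_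
  rcases eq_or_ne k l with rfl | h
  · cases hk : X.pos k <;> simp [derOp, posOp, hk, Derivation.leibniz, add_comm]
  · cases hk : X.pos k <;> cases hl : X.pos l <;>
    simp [derOp, posOp, hk, hl, Derivation.leibniz, h, h.symm,
      pderiv_comm k l, mul_left_comm]

theorem posOp_comm (X : Quadrant) (k l : Var) :
    posOp X k * posOp X l = posOp X l * posOp X k := by
  refine LinearMap.ext fun f => ?_
  rcases eq_or_ne k l with rfl | h
  · rfl
  · cases hk : X.pos k <;> cases hl : X.pos l <;>
    simp [posOp, hk, hl, Derivation.leibniz, h, h.symm,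
      pderiv_comm k l, mul_left_comm]

theorem derOp_comm (X : Quadrant) (k l : Var) :
    derOp X k * derOp X l = derOp X l * derOp X k := by
  refine LinearMap.ext fun f => ?_
  rcases eq_or_ne k l with rfl | h
  · rfl
  · cases hk : X.pos k <;> cases hl : X.pos l <;>
    simp [derOp, hk, hl, Derivation.leibniz, h, h.symm,
      pderiv_comm k l, mul_left_comm]

theorem lie_quad (X : Quadrant) (k l m n : Var) :
    ⁅posOp X k * derOp X l, posOp X m * derOp X n⁆ =
      (if l = m then posOp X k * derOp X n else 0) -
        if n = k then posOp X m * derOp X l else 0 := by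
  have h1 : posOp X k * derOp X l * (posOp X m * derOp X n) =
      posOp X k * (derOp X l * posOp X m) * derOp X n := by simp only [mul_assoc]
  have h2 : posOp X m * derOp X n * (posOp X k * derOp X l) =
      posOp X m * (derOp X n * posOp X k) * derOp X l := by simp only [mul_assoc]
  have h3 : posOp X k * (posOp X m * derOp X l) * derOp X n =
      posOp X m * (posOp X k * derOp X n) * derOp X l := by
    rw [← mul_assoc, ← mul_assoc, posOp_comm X k m, mul_assoc _ _ (derOp X n), derOp_comm X l n]
    simp only [mul_assoc]
  rw [Ring.lie_def, h1, h2, derOp_posOp, derOp_posOp, mul_add, mul_add, add_mul, add_mul, h3]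
  split_ifs <;> simp

theorem sum_aux {ι M : Type} [Fintype ι] [DecidableEq ι] [AddCommGroup M] [Module ℂ M]
    (B C : Matrix ι ι ℂ) (E : ι → ι → M) :
    ∑ k, ∑ l, ∑ m, ∑ n, B k l • C m n •
      ((if l = m then E k n else 0) - if n = k then E m l else 0) =
    ∑ k, ∑ l, (B * C - C * B) k l • E k l := by
  simp only [smul_sub, smul_ite, smul_zero, Finset.sum_sub_distrib, Matrix.sub_apply, sub_smul,
    Matrix.mul_apply, Finset.sum_smul, mul_smul]
  congr 1
  · refine Finset.sum_congr rfl fun k _ => ?_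
    rw [Finset.sum_comm (s := Finset.univ) (t := Finset.univ) (f := fun l x => B k x • C x l • E k l)]
    refine Finset.sum_congr rfl fun l _ => ?_
    rw [Finset.sum_comm]
    simp only [Finset.sum_ite_eq, Finset.mem_univ, if_true]
  · simp only [Finset.sum_ite_eq', Finset.mem_univ, if_true]
    rw [Finset.sum_comm]
    rw [Finset.sum_comm (s := Finset.univ) (t := Finset.univ) (f := fun k l => ∑ x, C k x • B x l • E k l)]
    refine Finset.sum_congr rfl fun l _ => ?_
    rw [Finset.sum_comm]
    refine Finset.sum_congr rfl fun m _ => Finset.sum_congr rfl fun k _ => ?_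
    rw [smul_comm]

theorem sum_lie_aux {ι A : Type} [Fintype ι] [DecidableEq ι] [Ring A] [Algebra ℂ A]
    (E : ι → ι → A) (h : ∀ k l m n, ⁅E k l, E m n⁆ = (if l = m then E k n else 0) - if n = k then E m l else 0)
    (B C : Matrix ι ι ℂ) :
    ⁅∑ k, ∑ l, B k l • E k l, ∑ k, ∑ l, C k l • E k l⁆ = ∑ k, ∑ l, (B * C - C * B) k l • E k l := by
  rw [← sum_aux]
  rw [sum_lie]
  refine Finset.sum_congr rfl fun k _ => ?_
  rw [sum_lie]
  refine Finset.sum_congr rfl fun l _ => ?_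
  rw [lie_sum]
  refine Finset.sum_congr rfl fun m _ => ?_
  rw [lie_sum]
  refine Finset.sum_congr rfl fun n _ => ?_
  rw [smul_lie, lie_smul, h]

/-- The operator `∑ B k l (xz)ₖ ∂ₗ` on `V_X`. -/
def quadOp (X : Quadrant) (B : Matrix Var Var ℂ) : Module.End ℂ V :=
  ∑ k, ∑ l, B k l • (posOp X k * derOp X l)

theorem quadOp_lie (X : Quadrant) (B C : Matrix Var Var ℂ) :
    quadOp X (B * C - C * B) = ⁅quadOp X B, quadOp X C⁆ :=
  (sum_lie_aux (fun k l => posOp X k * derOp X l) (lie_quad X) B C).symm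

/-- The operator `Y♯ = -4/3 ∑ xᵢ ∂ᵢ + ∑ zₐ ∂ₐ` on `V_X`. -/
def ySharp (X : Quadrant) : Module.End ℂ V :=
  -(4 / 3 : ℂ) • ∑ i, posOp X (.inl i) * derOp X (.inl i) +
    ∑ a, posOp X (.inr a) * derOp X (.inr a)

/-- The operator on `V_X` by which an element of `𝔤₀` acts: an element of `sl₃(ℂ)` acts as
`∑ A i j xᵢ ∂ⱼ`, an element of `sl₂(ℂ)` acts as `∑ S a b zₐ ∂_b`, and the element `Y` of `𝔤₀`, which
is the vector field `2/3 ∑ xᵢ ∂ᵢ`, acts as `Y♯`.  Here `A = (A - 1/3 tr A) + 1/2 (tr A) Y`. -/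
def rhoFun (X : Quadrant) (g : G0) : Module.End ℂ V :=
  ∑ i, ∑ j, (g.1 - (g.1.trace / 3) • (1 : Matrix (Fin 3) (Fin 3) ℂ)) i j •
      (posOp X (.inl i) * derOp X (.inl j)) +
    ∑ a, ∑ b, g.2.1 a b • (posOp X (.inr a) * derOp X (.inr b)) +
    (g.1.trace / 2) • ySharp X

/-- The matrix of the quadratic expression by which an element of `𝔤₀` acts. -/
def rhoMat (g : G0) : Matrix Var Var ℂ :=
  Matrix.fromBlocks (g.1 - g.1.trace • (1 : Matrix (Fin 3) (Fin 3) ℂ)) 0 0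
    (g.2.1 + (g.1.trace / 2) • (1 : Matrix (Fin 2) (Fin 2) ℂ))

theorem rhoFun_eq (X : Quadrant) (g : G0) : rhoFun X g = quadOp X (rhoMat g) := by
  simp only [rhoFun, quadOp, rhoMat, ySharp, Fintype.sum_sum_type, Matrix.fromBlocks_apply₁₁,
    Matrix.fromBlocks_apply₁₂, Matrix.fromBlocks_apply₂₁, Matrix.fromBlocks_apply₂₂,
    Matrix.zero_apply, zero_smul, add_zero, zero_add, Fin.sum_univ_three,
    Fin.sum_univ_two, Matrix.sub_apply, Matrix.add_apply, Matrix.smul_apply, Matrix.one_apply,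
    smul_eq_mul]
  simp
  module

theorem rhoMat_lie (g h : G0) : rhoMat ⁅g, h⁆ = rhoMat g * rhoMat h - rhoMat h * rhoMat g := by
  have h1 : ⁅g, h⁆.1 = g.1 * h.1 - h.1 * g.1 := rfl
  have h2 : ⁅g, h⁆.2.1 = g.2.1 * h.2.1 - h.2.1 * g.2.1 := rfl
  have h3 : (g.1 * h.1 - h.1 * g.1).trace = 0 := by
    rw [Matrix.trace_sub, Matrix.trace_mul_comm, sub_self]
  rw [rhoMat, h1, h2, h3, rhoMat, rhoMat, Matrix.fromBlocks_multiply, Matrix.fromBlocks_multiply,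
    sub_eq_add_neg (Matrix.fromBlocks _ _ _ _), Matrix.fromBlocks_neg, Matrix.fromBlocks_add]
  congr 1
  · simp only [Matrix.mul_sub, Matrix.sub_mul, Matrix.mul_smul, Matrix.smul_mul, Matrix.mul_one,
      Matrix.one_mul, Matrix.mul_zero]
    module
  · simp
  · simp
  · simp only [Matrix.mul_add, Matrix.add_mul, Matrix.mul_smul, Matrix.smul_mul, Matrix.mul_one,
      Matrix.one_mul, Matrix.mul_zero]
    module

/-- The action of `𝔤₀` on `V_X`. -/
def rho (X : Quadrant) : G0 →ₗ⁅ℂ⁆ Module.End ℂ V where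
  toFun := rhoFun X
  map_add' g h := by
    have h1 : rhoMat (g + h) = rhoMat g + rhoMat h := by
      rw [rhoMat, rhoMat, rhoMat, Matrix.fromBlocks_add]
      congr 1
      · change g.1 + h.1 - (g.1 + h.1).trace • 1 = _
        rw [Matrix.trace_add]
        module
      · simp
      · simp
      · change g.2.1 + h.2.1 + ((g.1 + h.1).trace / 2) • 1 = _
        rw [Matrix.trace_add]
        module
    simp only [rhoFun_eq, h1, quadOp, Matrix.add_apply, add_smul, Finset.sum_add_distrib]
  map_smul' c g := by
    have h1 : rhoMat (c • g) = c • rhoMat g := by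
      rw [rhoMat, rhoMat, Matrix.fromBlocks_smul]
      congr 1
      · change c • g.1 - (c • g.1).trace • 1 = _
        rw [Matrix.trace_smul, smul_eq_mul]
        module
      · simp
      · simp
      · change c • g.2.1 + ((c • g.1).trace / 2) • 1 = _
        rw [Matrix.trace_smul, smul_eq_mul]
        module
    simp only [rhoFun_eq, h1, quadOp, Matrix.smul_apply, smul_eq_mul, mul_smul, Finset.smul_sum,
      RingHom.id_apply]
  map_lie' {g h} := by rw [rhoFun_eq, rhoMat_lie, quadOp_lie, rhoFun_eq, rhoFun_eq]

theorem rho_lie (X : Quadrant) (g h : G0) :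
    rho X ⁅g, h⁆ = rho X g * rho X h - rho X h * rho X g := by
  rw [LieHom.map_lie, LieRing.of_associative_ring_bracket]

/-- The subspace `ℂ[z₊, z₋] 1_X` (for `X = A, C`) or `ℂ[∂₊, ∂₋] 1_X` (for `X = B, D`) of `V_X`. -/
def Vz : Submodule ℂ V :=
  Subalgebra.toSubmodule (MvPolynomial.supported ℂ (Set.range (Sum.inr : Fin 2 → Var)))

theorem X_mul_mem (a : Fin 2) (f : V) (hf : f ∈ Vz) : MvPolynomial.X (.inr a) * f ∈ Vz :=
  mul_mem (S := Subalgebra ℂ V) (s := MvPolynomial.supported ℂ (Set.range (Sum.inr : Fin 2 → Var)))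
    (MvPolynomial.X_mem_supported.2 ⟨a, rfl⟩) hf

theorem pderiv_mem (a : Fin 2) (f : V) (hf : f ∈ Vz) : MvPolynomial.pderiv (.inr a) f ∈ Vz := by
  change f ∈ Algebra.adjoin ℂ _ at hf
  induction hf using Algebra.adjoin_induction with
  | mem x hx =>
    obtain ⟨_, ⟨b, rfl⟩, rfl⟩ := hx
    rw [MvPolynomial.pderiv_X, Pi.single_apply]
    split_ifs
    · exact one_mem (MvPolynomial.supported ℂ (Set.range (Sum.inr : Fin 2 → Var)))
    · exact zero_mem _
  | algebraMap r =>
    rw [Derivation.map_algebraMap]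
    exact zero_mem _
  | add x y _ _ hx hy =>
    rw [map_add]
    exact add_mem hx hy
  | mul x y hx' hy' hx hy =>
    rw [Derivation.leibniz]
    exact add_mem (mul_mem (s := MvPolynomial.supported ℂ (Set.range (Sum.inr : Fin 2 → Var))) hx' hy)
      (mul_mem (s := MvPolynomial.supported ℂ (Set.range (Sum.inr : Fin 2 → Var))) hy' hx)

theorem pderiv_inl (i : Fin 3) (f : V) (hf : f ∈ Vz) : MvPolynomial.pderiv (.inl i) f = 0 := by
  refine MvPolynomial.pderiv_eq_zero_of_notMem_vars fun h => ?_
  obtain ⟨b, hb⟩ := MvPolynomial.mem_supported.1 hf h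
  cases hb

theorem posOp_mem (X : Quadrant) (a : Fin 2) (f : V) (hf : f ∈ Vz) :
    posOp X (.inr a) f ∈ Vz := by
  unfold posOp
  split_ifs
  · exact X_mul_mem a f hf
  · exact neg_mem (pderiv_mem a f hf)

theorem derOp_mem (X : Quadrant) (a : Fin 2) (f : V) (hf : f ∈ Vz) :
    derOp X (.inr a) f ∈ Vz := by
  unfold derOp
  split_ifs
  · exact pderiv_mem a f hf
  · exact X_mul_mem a f hf

theorem quad_mem (X : Quadrant) (i j : Fin 3) (f : V) (hf : f ∈ Vz) :
    posOp X (.inl i) (derOp X (.inl j) f) ∈ Vz := by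
  have h : ∀ k k' : Fin 3, X.pos (.inl k) = X.pos (.inl k') := by
    cases X <;> exact fun _ _ => rfl
  unfold posOp derOp
  rw [h i j]
  split_ifs
  · change MvPolynomial.X (.inl i) * MvPolynomial.pderiv (.inl j) f ∈ Vz
    rw [pderiv_inl j f hf, mul_zero]
    exact zero_mem _
  · rw [LinearMap.neg_apply, LinearMap.mulLeft_apply, Derivation.coeFn_coe,
      Derivation.leibniz, pderiv_inl i f hf, smul_zero, zero_add,
      MvPolynomial.pderiv_X, Pi.single_apply]
    split_ifs
    · rw [smul_eq_mul, mul_one]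
      exact neg_mem hf
    · rw [smul_zero]
      exact neg_mem (zero_mem _)

theorem rho_mem (X : Quadrant) (g : G0) (f : V) (hf : f ∈ Vz) : rho X g f ∈ Vz := by
  change rhoFun X g f ∈ Vz
  simp only [rhoFun, ySharp, LinearMap.add_apply, LinearMap.smul_apply, LinearMap.sum_apply,
    Module.End.mul_apply]
  refine add_mem (add_mem (sum_mem fun i _ => sum_mem fun j _ => Submodule.smul_mem _ _ ?_)
    (sum_mem fun a _ => sum_mem fun b _ => Submodule.smul_mem _ _ ?_)) (Submodule.smul_mem _ _
    (add_mem (Submodule.smul_mem _ _ (sum_mem fun i _ => ?_)) (sum_mem fun a _ => ?_)))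
  · exact quad_mem X i j f hf
  · exact posOp_mem X a _ (derOp_mem X b f hf)
  · exact quad_mem X i i f hf
  · exact posOp_mem X a _ (derOp_mem X a f hf)

/-- The `𝔤₀`-submodule `V_{X''}` of `V_X`: the action of `𝔤₀` on `ℂ[z₊, z₋] 1_X` or
`ℂ[∂₊, ∂₋] 1_X`. -/
def rhoZ (X : Quadrant) : G0 →ₗ⁅ℂ⁆ Module.End ℂ Vz where
  toFun g := (rho X g).restrict (rho_mem X g)
  map_add' g h := by
    refine LinearMap.ext fun f => Subtype.ext ?_
    exact LinearMap.congr_fun (map_add (rho X) g h) f.1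
  map_smul' c g := by
    refine LinearMap.ext fun f => Subtype.ext ?_
    exact LinearMap.congr_fun (map_smul (rho X) c g) f.1
  map_lie' {g h} := by
    rw [LieRing.of_associative_ring_bracket]
    exact LinearMap.ext fun f => Subtype.ext (LinearMap.congr_fun (rho_lie X g h) f.1)

/-- The operator `∂ₐ` on `V_{X''}`. -/
def derZ (X : Quadrant) (a : Fin 2) : Module.End ℂ Vz :=
  (derOp X (.inr a)).restrict (derOp_mem X a)

/-! ### Induced modules -/

/-- The universal enveloping algebra of `E(3,8)`. -/
abbrev U : Type := Env Even Odd

section Verma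

variable {W W' : Type} [AddCommGroup W] [Module ℂ W] [AddCommGroup W'] [Module ℂ W']
  (r : G0 →ₗ⁅ℂ⁆ Module.End ℂ W) (r' : G0 →ₗ⁅ℂ⁆ Module.End ℂ W')

/-- The relations `u ⊗ w = 1 ⊗ u w`, `u ∈ L₀`, of the induced module.  Here `L₀` is the subalgebra
of the elements of non-negative degree, which acts on the `𝔤₀`-module `W` through its degree zero
component, so that the elements of positive degree, and all odd elements of `L₀`, act by zero. -/
def vermaRel : Submodule U (U ⊗[ℂ] W) :=
  Submodule.span U
    ({t | ∃ x ∈ evenDegGE 0, ∃ w : W, t = ofEven Even Odd x ⊗ₜ[ℂ] w - 1 ⊗ₜ[ℂ] r (proj x) w} ∪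
      {t | ∃ a ∈ oddDegGE 0, ∃ w : W, t = ofOdd Even Odd a ⊗ₜ[ℂ] w})

/-- The induced module `M(W) = U(E(3,8)) ⊗_{U(L₀)} W`, where the `𝔤₀`-module `W` is extended to
`L₀` by letting the elements of positive degree act by zero. -/
def Verma : Type := (U ⊗[ℂ] W) ⧸ vermaRel r

instance : AddCommGroup (Verma r) := inferInstanceAs (AddCommGroup ((U ⊗[ℂ] W) ⧸ vermaRel r))

instance : Module U (Verma r) := inferInstanceAs (Module U ((U ⊗[ℂ] W) ⧸ vermaRel r))

/-- The element `u ⊗ w` of `M(W)`. -/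
def Verma.tmul (u : U) (w : W) : Verma r := (vermaRel r).mkQ (u ⊗ₜ[ℂ] w)

variable {r r'} in
/-- The morphism `M(W) → M(W')`, `u ⊗ w ↦ u ⊗ f(w)`, given by a morphism `f` of `𝔤₀`-modules. -/
def Verma.map (f : W →ₗ[ℂ] W') (hf : ∀ g w, f (r g w) = r' g (f w)) : Verma r →ₗ[U] Verma r' :=
  (vermaRel r).mapQ (vermaRel r') (f.baseChange U) (by
    rw [vermaRel, Submodule.span_le]
    rintro t (⟨x, hx, w, rfl⟩ | ⟨a, ha, w, rfl⟩)
    · refine Submodule.subset_span (Or.inl ⟨x, hx, f w, ?_⟩)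
      rw [map_sub, LinearMap.baseChange_tmul, LinearMap.baseChange_tmul, hf]
    · exact Submodule.subset_span (Or.inr ⟨a, ha, f w, LinearMap.baseChange_tmul _ _ _⟩))

end Verma

/-- The `E(3,8)`-module `M(V_X)`. -/
abbrev M (X : Quadrant) : Type := Verma (rho X)

/-- The `E(3,8)`-module `M_{X''} = M(V_{X''})`. -/
abbrev MZ (X : Quadrant) : Type := Verma (rhoZ X)

/-- The canonical morphism `M_{X''} → M(V_X)` given by the inclusion of `V_{X''}` in `V_X`. -/
def incl (X : Quadrant) : MZ X →ₗ[U] M X := Verma.map Vz.subtype fun _ _ => rfl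

/-- The elements `dᵢᵃ = xᵢ ⊗ εᵃ` of degree `-1` of `E(3,8)`, in the enveloping algebra. -/
def d (i : Fin 3) (a : Fin 2) : U :=
  ofOdd Even Odd (show Odd from (Pi.single a (MvPowerSeries.X i), 0))

/-- The map `φ` is `∇ = ∑ dᵢᵃ ⊗ ∂ᵢ ∂ₐ`. -/
def IsNabla (X : Quadrant) (φ : M X →ₗ[U] M X) : Prop :=
  ∀ (u : U) (v : V), φ (Verma.tmul (rho X) u v) =
    ∑ i, ∑ a, Verma.tmul (rho X) (u * d i a) (derOp X (.inl i) (derOp X (.inr a) v))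

/-- The map `φ` from `M_{X''}` to `M_{Y''}` is `∇₃ = ∑ d₁ᵃ d₂ᵇ d₃ᶜ ⊗ ∂ₐ ∂_b ∂_c`: it sends
`u ⊗ f 1_X` to `∑ u d₁ᵃ d₂ᵇ d₃ᶜ ⊗ ∂ₐ ∂_b ∂_c f 1_Y`. -/
def IsNabla3 (X Y : Quadrant) (φ : MZ X →ₗ[U] MZ Y) : Prop :=
  ∀ (u : U) (f : Vz), φ (Verma.tmul (rhoZ X) u f) =
    ∑ a, ∑ b, ∑ c, Verma.tmul (rhoZ Y) (u * (d 0 a * d 1 b * d 2 c))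
      (derZ Y a (derZ Y b (derZ Y c f)))

end E38

end

/-! A morphism from `M(V)` to a module `M` is the same as a linear map `V → M` that intertwines the
action of `L₀` (`IsVacuum`, `Verma.lift`). So each of `∇` and `∇₃` is determined by one linear map,
and the work is to see how `L₀` acts on it.

For commuting operators `p₊, p₋` (here `∂₊, ∂₋`) let `Dᵢ φ = ∑ₐ dᵢᵃ φ pₐ` act on linear maps `φ`
into a `U`-module (`dOp`); `D₁, D₂, D₃` carry the Lean indices `0, 1, 2`. With `ι` the map `v ↦ 1 ⊗
v`, the map `∇` is given by `∑ᵢ (Dᵢ ι) ∂ᵢ` and `∇₃` by `D₁ D₂ D₃ ι`. The bracket of `dᵢᵃ` and `dⱼᵇ`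
is a multiple of `εᵃ ∧ εᵇ`, and commuting `pₐ` see only the part symmetric in `a, b`. Hence the `Dᵢ`
anticommute (`dOp_dOp`), and any product of four of them is zero. This gives (b): `∇∇₃` is a sum of
terms `D₁ D₂ D₃ Dᵢ`. For `∇₃∇`, setting `xᵢ = 0` makes `M_{X''}` a retract of `M(V_X)` when `X = A,
B`; composing `∇` with the retraction and `∇₃` gives terms `Dᵢ D₁ D₂ D₃`.

For the intertwining property, `𝔤₀` moves the `Dᵢ` among themselves by the matrix `A - tr A`
(`dOp_comp_add_linPart`), the `sl₂` and divergence terms being absorbed by the `pₐ`. In `∇` this is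
undone by the `∂ᵢ`, and elements of positive degree give quadratic expressions in `H` whose sum
vanishes (`sum_rho_oddBr`). In `∇₃` the product `D₁ D₂ D₃` picks up the character `tr (A - tr A) =
-2 tr A`. This is the difference between `V_{A''}` and `V_{C''}`, where `xᵢ ∂ⱼ` acts as `-δᵢⱼ`
(`rho_apply_of_mem`). The positive part of `L₀` is treated by moving an element past one `Dᵢ` at a
time: its actions on `Dᵢ ι` (`OddCompat`), on `D₂ D₃ ι`, and then on `D₁ D₂ D₃ ι`, where all
contributions cancel (`IsVacuum.dOp_dOp_dOp`). -/

noncomputable section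

namespace E38

attribute [local instance 100] LieRing.ofAssociativeRing

/-! ### Taylor coefficients at the origin -/

/-- The value of a formal power series at the origin. -/
def ev0 : O →+* ℂ := MvPowerSeries.constantCoeff

theorem ev0_smul (c : ℂ) (f : O) : ev0 (c • f) = c * ev0 f := by
  simp only [ev0, ← MvPowerSeries.coeff_zero_eq_constantCoeff_apply, MvPowerSeries.coeff_smul]

theorem ev0_X (i : Fin 3) : ev0 (MvPowerSeries.X i) = 0 := MvPowerSeries.constantCoeff_X i

theorem pd_X (i j : Fin 3) : pd i (MvPowerSeries.X j) = if j = i then 1 else 0 := by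
  rw [pd, MvPowerSeries.pderiv_X, Pi.single_apply]

theorem pd_one (i : Fin 3) : pd i 1 = 0 := Derivation.map_one_eq_zero _

theorem ev0_pd (i : Fin 3) (f : O) :
    ev0 (pd i f) = MvPowerSeries.coeff (Finsupp.single i 1) f := by
  rw [ev0, ← MvPowerSeries.coeff_zero_eq_constantCoeff_apply, pd, MvPowerSeries.coeff_pderiv]
  simp

/-- Only constant vector fields have negative degree, namely `-2`; the `sl₂` and 2-form components
start in degrees `0` and `4`. -/
theorem mem_evenDegGE_zero {x : Even} : x ∈ evenDegGE 0 ↔ ∀ i, ev0 (x.vec i) = 0 := by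
  constructor
  · intro h i
    have := (h 0).1 (by simp) i
    rwa [MvPowerSeries.coeff_zero_eq_constantCoeff_apply] at this
  · intro h n
    refine ⟨fun hn i => ?_, fun hn => by omega, fun hn => by omega⟩
    obtain rfl : n = 0 := by
      rw [← Finsupp.degree_eq_zero_iff]
      omega
    rw [MvPowerSeries.coeff_zero_eq_constantCoeff_apply]
    exact h i

/-- The negative odd degrees are `-3` (constants) and `-1` (linear functions); 2-forms start in
degree `1`. -/
theorem mem_oddDegGE_zero {b : Odd} :
    b ∈ oddDegGE 0 ↔ ∀ a, ev0 (b.fn a) = 0 ∧ ∀ i, ev0 (pd i (b.fn a)) = 0 := by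
  constructor
  · intro h a
    refine ⟨?_, fun i => ?_⟩
    · have := (h 0).1 (by simp) a
      rwa [MvPowerSeries.coeff_zero_eq_constantCoeff_apply] at this
    · rw [ev0_pd]
      exact (h (Finsupp.single i 1)).1 (by simp) a
  · intro h n
    refine ⟨fun hn a => ?_, fun hn => by omega⟩
    rcases Nat.lt_or_ge n.degree 1 with h1 | h1
    · obtain rfl : n = 0 := by
        rw [← Finsupp.degree_eq_zero_iff]
        omega
      rw [MvPowerSeries.coeff_zero_eq_constantCoeff_apply]
      exact (h a).1
    · obtain ⟨i, rfl⟩ : ∃ i, n = Finsupp.single i 1 := by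
        have h2 : n.degree = 1 := by omega
        have h3 : n ≠ 0 := fun h => by simp [h] at h2
        obtain ⟨i, hi⟩ := Finsupp.ne_iff.1 h3
        refine ⟨i, ?_⟩
        have h4 : Finsupp.single i 1 ≤ n := by
          rw [Finsupp.single_le_iff]
          have : n i ≠ 0 := hi
          omega
        obtain ⟨m, rfl⟩ := exists_add_of_le h4
        rw [map_add, Finsupp.degree_single] at h2
        rw [(Finsupp.degree_eq_zero_iff m).1 (by omega), add_zero]
      rw [← ev0_pd]
      exact (h a).2 i

/-! ### Brackets with the elements `dᵢᵃ` -/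

/-- The element `xᵢ ⊗ εᵃ`. -/
def dd (i : Fin 3) (a : Fin 2) : Odd := (Pi.single a (MvPowerSeries.X i), 0)

theorem fn_dd (i : Fin 3) (a b : Fin 2) :
    (dd i a).fn b = if b = a then MvPowerSeries.X i else 0 := by
  rw [← Pi.single_apply]; rfl

theorem form_dd (i : Fin 3) (a : Fin 2) : (dd i a).form = 0 := rfl

theorem d0_X (i : Fin 3) : d0 (MvPowerSeries.X i) = Pi.single i 1 := by
  ext1 j
  rw [d0, pd_X, Pi.single_apply]
  simp only [eq_comm]

theorem lieFun_zero (X : Vec) : lieFun X 0 = 0 := by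
  have h := lieFun_smul X 0 0
  rwa [zero_smul, zero_smul] at h

theorem lieFun_X (X : Vec) (i : Fin 3) : lieFun X (MvPowerSeries.X i) = X i := by
  simp [lieFun, pd_X]

theorem d2_zero : d2 0 = 0 := by
  simp [d2]

theorem lieForm2_zero (X : Vec) : lieForm2 X 0 = 0 := by
  ext1 i
  simp [lieForm2_apply, lieFun]

theorem fn_lie_dd (x : Even) (i : Fin 3) (a b : Fin 2) :
    (⁅x, dd i a⁆ : Odd).fn b =
      (if b = a then x.vec i - (1 / 2 : ℂ) • (d2 x.vec * MvPowerSeries.X i) else 0) +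
        x.mat b a * MvPowerSeries.X i := by
  rw [ofn_lie, eo0]
  simp only [fn_dd]
  by_cases h : b = a <;> simp [h, lieFun_X, lieFun_zero]

theorem form_lie_dd (x : Even) (i : Fin 3) (a b : Fin 2) :
    (⁅x, dd i a⁆ : Odd).form b =
      (if b = a then (1 / 2 : ℂ) • (d0 (d2 x.vec) ⨯₃ Pi.single i 1) +
        (MvPowerSeries.X i : O) • x.form else 0) + d0 (x.mat b a) ⨯₃ Pi.single i 1 := by
  have h0 : ∀ b, (dd i a).form b = 0 := fun _ => rfl
  have h1 : ∀ b, d0 ((dd i a).fn b) = if b = a then Pi.single i 1 else 0 := fun b => by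
    rw [fn_dd]; split_ifs
    · exact d0_X i
    · exact d0_zero
  rw [oform_lie, eo2]
  simp only [h0, h1, lieForm2_zero]
  simp only [fn_dd, smul_zero, Finset.sum_const_zero, sub_zero, zero_add,
    apply_ite (crossProduct _), map_zero, Finset.sum_ite_eq', Finset.mem_univ, if_true, ite_smul,
    zero_smul]
  split_ifs
  · abel
  · simp only [smul_zero, zero_add, add_zero]

theorem vec_oddBr_dd_zero (b : Odd) (i : Fin 3) :
    (oddBr b (dd i 0)).vec =
      d0 (b.fn 1) ⨯₃ Pi.single i 1 - (MvPowerSeries.X i : O) • b.form 1 := by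
  rw [vec_oddBr, ooVec]
  simp [fn_dd, form_dd, d0_X, d0_zero]

theorem vec_oddBr_dd_one (b : Odd) (i : Fin 3) :
    (oddBr b (dd i 1)).vec =
      -(d0 (b.fn 0) ⨯₃ Pi.single i 1) + (MvPowerSeries.X i : O) • b.form 0 := by
  rw [vec_oddBr, ooVec]
  simp [fn_dd, form_dd, d0_X, d0_zero]

theorem ooK_zero_right (f : O) : ooK f 0 = 0 := by simp [ooK, d2_zero]
theorem ooK_zero_left (τ : Vec) : ooK 0 τ = 0 := by simp [ooK, d0_zero]
theorem ooK_X (i : Fin 3) (τ : Vec) :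
    ooK (MvPowerSeries.X i) τ = τ i - MvPowerSeries.X i * d2 τ := by
  simp [ooK, d0_X]

theorem mat_oddBr_dd_zero (b : Odd) (i : Fin 3) :
    (oddBr b (dd i 0)).mat =
      !![(1 / 2 : ℂ) • ooK (MvPowerSeries.X i) (b.form 1), -ooK (MvPowerSeries.X i) (b.form 0);
        0, -(1 / 2 : ℂ) • ooK (MvPowerSeries.X i) (b.form 1)] := by
  rw [mat_oddBr, ooSl]
  simp [fn_dd, form_dd, ooK_zero_left, ooK_zero_right]

theorem mat_oddBr_dd_one (b : Odd) (i : Fin 3) :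
    (oddBr b (dd i 1)).mat =
      !![(1 / 2 : ℂ) • ooK (MvPowerSeries.X i) (b.form 0), 0; ooK (MvPowerSeries.X i) (b.form 1),
        -(1 / 2 : ℂ) • ooK (MvPowerSeries.X i) (b.form 0)] := by
  rw [mat_oddBr, ooSl]
  simp [fn_dd, form_dd, ooK_zero_left, ooK_zero_right]

/-! ### The linear part of an odd element -/

/-- The component of degree `-1` of an odd element. -/
def linPart (b : Odd) : Odd := ∑ l, ∑ c, ev0 (pd l (b.fn c)) • dd l c

theorem ofn_sum {ι : Type} (s : Finset ι) (b : ι → Odd) (a : Fin 2) :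
    (∑ i ∈ s, b i).fn a = ∑ i ∈ s, (b i).fn a := by
  induction s using Finset.cons_induction with
  | empty => rfl
  | cons i s hi ih => rw [Finset.sum_cons, Finset.sum_cons, ← ih]; rfl

theorem oform_sum {ι : Type} (s : Finset ι) (b : ι → Odd) :
    (∑ i ∈ s, b i).form = ∑ i ∈ s, (b i).form := by
  induction s using Finset.cons_induction with
  | empty => rfl
  | cons i s hi ih => rw [Finset.sum_cons, Finset.sum_cons, ← ih]; rfl

theorem fn_linPart (b : Odd) (a : Fin 2) :
    (linPart b).fn a = ∑ l, ev0 (pd l (b.fn a)) • (MvPowerSeries.X l : O) := by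
  rw [linPart, ofn_sum]
  simp only [ofn_sum, ofn_smul, Pi.smul_apply, fn_dd, smul_ite, smul_zero, Finset.sum_ite_eq,
    Finset.mem_univ, if_true]

theorem form_linPart (b : Odd) : (linPart b).form = 0 := by
  rw [linPart, oform_sum]
  simp only [oform_sum, oform_smul, form_dd, smul_zero, Finset.sum_const_zero]

/-- The sum of the components of degree greater than `-1` of an odd element. -/
def posPart (b : Odd) : Odd := b - linPart b

theorem linPart_add_posPart (b : Odd) : linPart b + posPart b = b := add_sub_cancel _ _

theorem fn_posPart (b : Odd) (a : Fin 2) :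
    (posPart b).fn a = b.fn a - ∑ l, ev0 (pd l (b.fn a)) • (MvPowerSeries.X l : O) := by
  rw [← fn_linPart]; rfl

theorem form_posPart (b : Odd) : (posPart b).form = b.form := by
  have h : (posPart b).form = b.form - (linPart b).form := rfl
  rw [h, form_linPart, sub_zero]

theorem ev0_pd_pd_fn_posPart (b : Odd) (a : Fin 2) (l m : Fin 3) :
    ev0 (pd l (pd m ((posPart b).fn a))) = ev0 (pd l (pd m (b.fn a))) := by
  simp only [fn_posPart, map_sub, map_sum, pd_smul, pd_X, apply_ite (pd l), pd_one, map_zero,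
    ite_self, smul_zero, Finset.sum_const_zero, sub_zero]

/-- The hypothesis removes degree `-3`, and subtracting `linPart` removes degree `-1`. -/
theorem posPart_mem {b : Odd} (h : ∀ a, ev0 (b.fn a) = 0) : posPart b ∈ oddDegGE 0 := by
  refine mem_oddDegGE_zero.2 fun a => ⟨?_, fun i => ?_⟩
  · simp only [fn_posPart, map_sub, h, map_sum, ev0_smul, ev0_X, mul_zero, Finset.sum_const_zero,
      sub_zero]
  · simp only [fn_posPart, map_sub, map_sum, pd_smul, pd_X, ev0_smul, apply_ite ev0,
      map_one, map_zero, mul_ite, mul_one, mul_zero, Finset.sum_ite_eq',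
      Finset.mem_univ, if_true, sub_self]

/-- A bracket of `L₀` with an element of degree `-1` has no component of degree `-3`. -/
theorem ev0_fn_lie_dd {x : Even} (hx : x ∈ evenDegGE 0) (i : Fin 3) (a b : Fin 2) :
    ev0 ((⁅x, dd i a⁆ : Odd).fn b) = 0 := by
  rw [fn_lie_dd]
  simp only [map_add, map_mul, apply_ite ev0, map_sub, ev0_smul, ev0_X, mem_evenDegGE_zero.1 hx,
    map_zero, mul_zero, sub_zero, ite_self, add_zero]

/-- Odd elements have odd degree, so `b` starts in degree `1` and the bracket in degree `0`. -/
theorem oddBr_dd_mem {b : Odd} (hb : b ∈ oddDegGE 0) (i : Fin 3) (a : Fin 2) :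
    oddBr b (dd i a) ∈ evenDegGE 0 := by
  have h := fun a l => (mem_oddDegGE_zero.1 hb a).2 l
  refine mem_evenDegGE_zero.2 fun j => ?_
  fin_cases a
  · rw [Fin.zero_eta, vec_oddBr_dd_zero]
    fin_cases j <;> simp [cross_apply, d0, h, ev0_X]
  · rw [Fin.mk_one, vec_oddBr_dd_one]
    fin_cases j <;> simp [cross_apply, d0, h, ev0_X]

theorem ev0_pd_fn_lie_dd (x : Even) (l i : Fin 3) (a b : Fin 2) :
    ev0 (pd l ((⁅x, dd i a⁆ : Odd).fn b)) =
      (if b = a then ev0 (pd l (x.vec i)) - (if i = l then ev0 (d2 x.vec) / 2 else 0) else 0) +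
        if i = l then ev0 (x.mat b a) else 0 := by
  rw [fn_lie_dd]
  by_cases h : b = a <;> by_cases h' : i = l <;>
    simp [h, h', pd_X, ev0_smul, ev0_X]; ring

/-! ### The universal enveloping algebra -/

section Env

variable (L₀ L₁ : Type) [LieRing L₀] [LieAlgebra ℂ L₀] [AddCommGroup L₁] [Module ℂ L₁]
  [LieRingModule L₀ L₁] [LieSuperalgebra L₀ L₁]

theorem ofEven_mul_ofOdd (x : L₀) (a : L₁) :
    ofEven L₀ L₁ x * ofOdd L₀ L₁ a = ofOdd L₀ L₁ a * ofEven L₀ L₁ x + ofOdd L₀ L₁ ⁅x, a⁆ := by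
  have h := RingQuot.mkAlgHom_rel ℂ (EnvRel.even_odd x a)
  rw [map_add, map_mul, map_mul] at h
  exact h

theorem ofOdd_mul_ofOdd (a b : L₁) :
    ofOdd L₀ L₁ a * ofOdd L₀ L₁ b =
      -(ofOdd L₀ L₁ b * ofOdd L₀ L₁ a) + ofEven L₀ L₁ (LieSuperalgebra.oddBracket a b) := by
  have h := RingQuot.mkAlgHom_rel ℂ (EnvRel.odd_odd (L₀ := L₀) a b)
  rw [map_add, map_neg, map_mul, map_mul] at h
  exact h

end Env

theorem d_eq (i : Fin 3) (a : Fin 2) : d i a = ofOdd Even Odd (dd i a) := rfl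

theorem ofEven_mul_d (x : Even) (i : Fin 3) (a : Fin 2) :
    ofEven Even Odd x * d i a = d i a * ofEven Even Odd x + ofOdd Even Odd ⁅x, dd i a⁆ :=
  ofEven_mul_ofOdd Even Odd x (dd i a)

theorem ofOdd_mul_d (b : Odd) (i : Fin 3) (a : Fin 2) :
    ofOdd Even Odd b * d i a =
      -(d i a * ofOdd Even Odd b) + ofEven Even Odd (oddBr b (dd i a)) :=
  ofOdd_mul_ofOdd Even Odd b (dd i a)

/-- The bracket is the constant vector field `-(dxᵢ ∧ dxⱼ)(εᵃ ∧ εᵇ)`, skew in `a, b`. The `dᵢᵃ`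
themselves do not anticommute; only their symmetrization in the upper indices does. -/
theorem oddBr_dd_dd (i j : Fin 3) (a b : Fin 2) :
    oddBr (dd i a) (dd j b) + oddBr (dd i b) (dd j a) = 0 := by
  apply Even.ext
  · change ooVec _ _ _ _ + ooVec _ _ _ _ = 0
    fin_cases a <;> fin_cases b <;> simp [ooVec, fn_dd, form_dd, d0_zero]
  · change ooSl _ _ _ _ + ooSl _ _ _ _ = 0
    simp [ooSl, form_dd, ooK_zero_right, ← Matrix.ext_iff]
  · change ooForm _ _ _ _ + ooForm _ _ _ _ = 0
    simp [ooForm, form_dd, d2_zero, d0_zero, d1]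

theorem d_mul_d (i j : Fin 3) (a b : Fin 2) :
    d i a * d j b + d j b * d i a + (d i b * d j a + d j a * d i b) = 0 := by
  rw [d_eq i a, d_eq i b, ofOdd_mul_d, ofOdd_mul_d, neg_add_cancel_comm, neg_add_cancel_comm,
    ← map_add, oddBr_dd_dd, map_zero]

/-! ### The operators `∑ₐ dᵢᵃ ⊗ ∂ₐ` -/

section Operators

variable {W W' M M' : Type} [AddCommGroup W] [Module ℂ W] [AddCommGroup W'] [Module ℂ W']
  [AddCommGroup M] [Module ℂ M] [Module U M] [IsScalarTower ℂ U M]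
  [AddCommGroup M'] [Module ℂ M'] [Module U M'] [IsScalarTower ℂ U M']

theorem comp_sum {κ W₁ W₂ W₃ : Type} [AddCommGroup W₁] [Module ℂ W₁] [AddCommGroup W₂]
    [Module ℂ W₂] [AddCommGroup W₃] [Module ℂ W₃] (s : Finset κ) (φ : W₂ →ₗ[ℂ] W₃)
    (T : κ → W₁ →ₗ[ℂ] W₂) : φ ∘ₗ (∑ i ∈ s, T i) = ∑ i ∈ s, φ ∘ₗ T i := by
  refine LinearMap.ext fun w => ?_
  simp

theorem sum_comp {κ W₁ W₂ W₃ : Type} [AddCommGroup W₁] [Module ℂ W₁] [AddCommGroup W₂]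
    [Module ℂ W₂] [AddCommGroup W₃] [Module ℂ W₃] (s : Finset κ) (φ : κ → W₂ →ₗ[ℂ] W₃)
    (T : W₁ →ₗ[ℂ] W₂) : (∑ i ∈ s, φ i) ∘ₗ T = ∑ i ∈ s, φ i ∘ₗ T := by
  refine LinearMap.ext fun w => ?_
  simp

/-- The operator `φ ↦ ∑ₐ dᵢᵃ φ pₐ` on linear maps into a `U`-module. -/
def dOp (p : Fin 2 → Module.End ℂ W) (i : Fin 3) : (W →ₗ[ℂ] M) →ₗ[ℂ] (W →ₗ[ℂ] M) where
  toFun φ := ∑ a, d i a • (φ ∘ₗ p a)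
  map_add' φ ψ := by simp only [LinearMap.add_comp, smul_add, Finset.sum_add_distrib]
  map_smul' c φ := by
    simp only [LinearMap.smul_comp, Finset.smul_sum, RingHom.id_apply]
    exact Finset.sum_congr rfl fun a _ => smul_comm _ _ _

variable {p : Fin 2 → Module.End ℂ W} {p' : Fin 2 → Module.End ℂ W'}

theorem dOp_eq_sum (i : Fin 3) (φ : W →ₗ[ℂ] M) : dOp p i φ = ∑ a, d i a • (φ ∘ₗ p a) := rfl

/-- Naturality in the source. It serves for `S = pₐ`, for `∂ᵢ` restricted to `V_{X''}`, and for the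
retraction onto `V_{X''}`. -/
theorem dOp_comp (i : Fin 3) (φ : W →ₗ[ℂ] M) (S : W' →ₗ[ℂ] W) (h : ∀ a, p a ∘ₗ S = S ∘ₗ p' a) :
    dOp p i φ ∘ₗ S = dOp p' i (φ ∘ₗ S) := by
  refine LinearMap.ext fun w => ?_
  simp only [dOp_eq_sum, LinearMap.comp_apply, LinearMap.sum_apply, LinearMap.smul_apply]
  exact Finset.sum_congr rfl fun a _ => by rw [← LinearMap.comp_apply (p a), h]; rfl

theorem comp_dOp (i : Fin 3) (φ : W →ₗ[ℂ] M) (F : M →ₗ[U] M') :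
    F.restrictScalars ℂ ∘ₗ dOp p i φ = dOp p i (F.restrictScalars ℂ ∘ₗ φ) := by
  refine LinearMap.ext fun w => ?_
  simp [dOp_eq_sum]

/-- In `∑ dᵢᵃ dⱼᵇ φ p_b pₐ` the commuting `p` symmetrize in `a, b`, which leaves the part for which
`d_mul_d` gives anticommutation. -/
theorem dOp_dOp (hp : ∀ a b, p a ∘ₗ p b = p b ∘ₗ p a) (i j : Fin 3) (φ : W →ₗ[ℂ] M) :
    dOp p i (dOp p j φ) = -dOp p j (dOp p i φ) := by
  refine LinearMap.ext fun w => ?_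
  have h : ∀ w, p 1 (p 0 w) = p 0 (p 1 w) := fun w => LinearMap.congr_fun (hp 1 0) w
  have e : ∀ a b (m : M), (d i a * d j b) • m =
      -((d j b * d i a) • m) - (d i b * d j a) • m - (d j a * d i b) • m := fun a b m => by
    have := congrArg (· • m) (d_mul_d i j a b)
    simp only [add_smul, zero_smul] at this
    rw [← sub_eq_zero, ← this]
    abel
  simp only [dOp_eq_sum, Fin.sum_univ_two, LinearMap.comp_apply, LinearMap.add_apply,
    LinearMap.smul_apply, smul_add, LinearMap.neg_apply, smul_smul, h]
  have e00 := e 0 0 (φ (p 0 (p 0 w)))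
  have e11 := e 1 1 (φ (p 1 (p 1 w)))
  have e01 := e 0 1 (φ (p 0 (p 1 w)))
  -- For `a = b` the relation occurs twice over and has to be divided by `2`.
  have two : ∀ u v : M, u = -v - u - v → u = -v := fun u v h => by
    have h2 : (2 : ℂ) • (u + v) = 0 := by
      rw [two_smul]; nth_rw 1 [h]; abel
    exact eq_neg_of_add_eq_zero_left ((smul_eq_zero.1 h2).resolve_left two_ne_zero)
  rw [two _ _ e00, two _ _ e11, e01]
  abel

theorem dOp_self (hp : ∀ a b, p a ∘ₗ p b = p b ∘ₗ p a) (i : Fin 3) (φ : W →ₗ[ℂ] M) :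
    dOp p i (dOp p i φ) = 0 := by
  have h := dOp_dOp hp i i φ
  have h2 : (2 : ℂ) • dOp p i (dOp p i φ) = 0 := by
    rw [two_smul]; nth_rw 1 [h]; abel
  exact (smul_eq_zero.1 h2).resolve_left two_ne_zero

/-- Exterior products of degree four in three generators vanish: move `Dᵢ` next to its equal. -/
theorem dOp_dOp_dOp_dOp (hp : ∀ a b, p a ∘ₗ p b = p b ∘ₗ p a) (i : Fin 3) (φ : W →ₗ[ℂ] M) :
    dOp p i (dOp p 0 (dOp p 1 (dOp p 2 φ))) = 0 := by
  fin_cases i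
  · exact dOp_self hp _ _
  · change dOp p 1 _ = 0
    rw [dOp_dOp hp, dOp_self hp, map_zero, neg_zero]
  · change dOp p 2 _ = 0
    rw [dOp_dOp hp, dOp_dOp hp 2, dOp_self hp, map_zero, neg_zero, map_zero, neg_zero]

theorem ofEven_smul_dOp (x : Even) (i : Fin 3) (φ : W →ₗ[ℂ] M) :
    ofEven Even Odd x • dOp p i φ =
      dOp p i (ofEven Even Odd x • φ) + ∑ a, ofOdd Even Odd ⁅x, dd i a⁆ • (φ ∘ₗ p a) := by
  simp only [dOp_eq_sum, Finset.smul_sum, ← Finset.sum_add_distrib]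
  refine Finset.sum_congr rfl fun a _ => ?_
  rw [smul_smul, ofEven_mul_d, add_smul, mul_smul]
  rfl

theorem ofOdd_smul_dOp (b : Odd) (i : Fin 3) (φ : W →ₗ[ℂ] M) :
    ofOdd Even Odd b • dOp p i φ =
      -dOp p i (ofOdd Even Odd b • φ) +
        ∑ a, ofEven Even Odd (oddBr b (dd i a)) • (φ ∘ₗ p a) := by
  simp only [dOp_eq_sum, Finset.smul_sum, ← Finset.sum_neg_distrib, ← Finset.sum_add_distrib]
  refine Finset.sum_congr rfl fun a _ => ?_
  rw [smul_smul, ofOdd_mul_d, add_smul, neg_smul, mul_smul]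
  rfl

/-! ### Compatibility with the action of `𝔤₀` -/

theorem proj_fst (x : Even) (l i : Fin 3) : (proj x).1 l i = ev0 (pd l (x.vec i)) :=
  (ev0_pd _ _).symm

theorem proj_snd (x : Even) (a b : Fin 2) : (proj x).2.1 a b = ev0 (x.mat a b) := rfl

theorem rhoMat_inl (g : G0) (l i : Fin 3) :
    rhoMat g (.inl l) (.inl i) = g.1 l i - if l = i then g.1.trace else 0 := by
  simp [rhoMat, Matrix.one_apply]

theorem rhoMat_inr (g : G0) (a b : Fin 2) :
    rhoMat g (.inr a) (.inr b) = g.2.1 a b + if a = b then g.1.trace / 2 else 0 := by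
  simp [rhoMat, Matrix.one_apply]

theorem trace_proj (x : Even) : (proj x).1.trace = ev0 (d2 x.vec) := by
  rw [Matrix.trace_fin_three, proj_fst, proj_fst, proj_fst, d2, map_add, map_add]

/-- The commutation relations of the operators `∂ₐ` with the action of `𝔤₀`. -/
def Compat (r : G0 →ₗ⁅ℂ⁆ Module.End ℂ W) (p : Fin 2 → Module.End ℂ W) : Prop :=
  ∀ g a, p a ∘ₗ r g = r g ∘ₗ p a + ∑ b, rhoMat g (.inr a) (.inr b) • p b

variable {r : G0 →ₗ⁅ℂ⁆ Module.End ℂ W}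

theorem ofOdd_linPart_smul (b : Odd) (φ : W →ₗ[ℂ] M) :
    ofOdd Even Odd (linPart b) • φ = ∑ l, ∑ c, ev0 (pd l (b.fn c)) • d l c • φ := by
  simp only [linPart, map_sum, map_smul, Finset.sum_smul, smul_assoc]
  rfl

/-- Equivariance of `D` in degree zero. The linear part of `[x, dᵢᵃ]` contains `A` on `xᵢ`, the
twist `-½ tr A`, and `sl₂` on `εᵃ`. Commuting `pₐ` past `r` gives minus the `sl₂` term and another
`-½ tr A`. So `A - tr A` remains, which is the `gl₃` block of `rhoMat`. -/
theorem dOp_comp_add_linPart (hr : Compat r p) (x : Even) (i : Fin 3) (φ : W →ₗ[ℂ] M) :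
    dOp p i (φ ∘ₗ r (proj x)) + ∑ a, ofOdd Even Odd (linPart ⁅x, dd i a⁆) • (φ ∘ₗ p a) =
      dOp p i φ ∘ₗ r (proj x) + ∑ l, rhoMat (proj x) (.inl l) (.inl i) • dOp p l φ := by
  have h : dOp p i φ ∘ₗ r (proj x) = dOp p i (φ ∘ₗ r (proj x)) +
      ∑ a, ∑ b, rhoMat (proj x) (.inr a) (.inr b) • d i a • (φ ∘ₗ p b) := by
    refine LinearMap.ext fun w => ?_
    have h := fun a => LinearMap.congr_fun (hr (proj x) a) w
    simp only [LinearMap.comp_apply, LinearMap.add_apply, Fin.sum_univ_two, LinearMap.smul_apply]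
      at h
    have hs : ∀ (u : U) (c : ℂ) (m : M), u • c • m = c • u • m := fun u c m => smul_comm u c m
    simp only [dOp_eq_sum, LinearMap.comp_apply, LinearMap.add_apply, LinearMap.smul_apply,
      Fin.sum_univ_two, h, map_add, smul_add, map_smul, hs]
    abel
  rw [h]
  simp only [ofOdd_linPart_smul, ev0_pd_fn_lie_dd, rhoMat_inl, rhoMat_inr, trace_proj, proj_fst,
    proj_snd, dOp_eq_sum, Fin.sum_univ_two, Fin.sum_univ_three]
  -- With the maps `d_l^c φ pₐ` taken as unknowns, only an identity between scalar coefficients is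
  -- left.
  obtain ⟨D, hD⟩ : ∃ D : Fin 3 → Fin 2 → Fin 2 → W →ₗ[ℂ] M, ∀ l c a, d l c • φ ∘ₗ p a = D l c a :=
    ⟨_, fun _ _ _ => rfl⟩
  obtain ⟨E, hE⟩ : ∃ E : Fin 3 → Fin 2 → W →ₗ[ℂ] M,
      ∀ l a, d l a • (φ ∘ₗ r (proj x)) ∘ₗ p a = E l a := ⟨_, fun _ _ => rfl⟩
  simp only [hD, hE]
  fin_cases i <;> simp <;> module

/-- The induction step for moving `x` through a product of `Dᵢ`: `ψ` is whatever `x` does to `φ`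
beyond the action of `𝔤₀` on the source. It is `0` for `φ = ι`, and the next two steps feed in the
outcome of the preceding one. -/
theorem ofEven_smul_dOp_of_eq (hr : Compat r p) {x : Even} {φ ψ : W →ₗ[ℂ] M}
    (h : ofEven Even Odd x • φ = φ ∘ₗ r (proj x) + ψ) (i : Fin 3) :
    ofEven Even Odd x • dOp p i φ = dOp p i φ ∘ₗ r (proj x) +
      ∑ l, rhoMat (proj x) (.inl l) (.inl i) • dOp p l φ + dOp p i ψ +
        ∑ a, ofOdd Even Odd (posPart ⁅x, dd i a⁆) • (φ ∘ₗ p a) := by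
  have e : ∀ a, ofOdd Even Odd ⁅x, dd i a⁆ = ofOdd Even Odd (linPart ⁅x, dd i a⁆) +
      ofOdd Even Odd (posPart ⁅x, dd i a⁆) := fun a => by rw [← map_add, linPart_add_posPart]
  rw [ofEven_smul_dOp, h, map_add]
  simp only [e, add_smul, Finset.sum_add_distrib]
  rw [← dOp_comp_add_linPart hr]
  abel

/-! ### Vacuum maps and the action of `L₀` on `Dᵢ ι` -/

/-- The linear map `ι` intertwines the action of `L₀` on `W` and on `M`: it induces a morphism from
the induced module `M(W)` to `M`. -/
structure IsVacuum (r : G0 →ₗ⁅ℂ⁆ Module.End ℂ W) (ι : W →ₗ[ℂ] M) : Prop where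
  even : ∀ x ∈ evenDegGE 0, ofEven Even Odd x • ι = ι ∘ₗ r (proj x)
  odd : ∀ b ∈ oddDegGE 0, ofOdd Even Odd b • ι = 0

variable {ι : W →ₗ[ℂ] M}

theorem posPart_lie_dd_mem {x : Even} (hx : x ∈ evenDegGE 0) (i : Fin 3) (a : Fin 2) :
    posPart ⁅x, dd i a⁆ ∈ oddDegGE 0 :=
  posPart_mem fun c => ev0_fn_lie_dd hx i a c

theorem comp_smul_eq (u : U) (φ : W →ₗ[ℂ] M) (T : Module.End ℂ W) :
    u • (φ ∘ₗ T) = (u • φ) ∘ₗ T := rfl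

/-- Beyond `𝔤₀` nothing contributes: the positive part of `[x, dᵢᵃ]` annihilates the vacuum. -/
theorem IsVacuum.ofEven_smul_dOp (hι : IsVacuum r ι) (hr : Compat r p) {x : Even}
    (hx : x ∈ evenDegGE 0) (i : Fin 3) :
    ofEven Even Odd x • dOp p i ι = dOp p i ι ∘ₗ r (proj x) +
      ∑ l, rhoMat (proj x) (.inl l) (.inl i) • dOp p l ι := by
  rw [ofEven_smul_dOp_of_eq hr (ψ := 0) (by rw [hι.even x hx, add_zero]), map_zero, add_zero]
  simp only [comp_smul_eq, hι.odd _ (posPart_lie_dd_mem hx i _), LinearMap.zero_comp,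
    Finset.sum_const_zero, add_zero]

theorem IsVacuum.ofOdd_smul_dOp (hι : IsVacuum r ι) {b : Odd} (hb : b ∈ oddDegGE 0) (i : Fin 3) :
    ofOdd Even Odd b • dOp p i ι = ι ∘ₗ ∑ a, r (proj (oddBr b (dd i a))) ∘ₗ p a := by
  rw [E38.ofOdd_smul_dOp, hι.odd b hb, map_zero, neg_zero, zero_add]
  simp only [comp_smul_eq, hι.even _ (oddBr_dd_mem hb i _), LinearMap.comp_assoc,
    comp_sum]

/-- If `t` are operators that behave as `∂ᵢ`, then `∑ᵢ Dᵢ ι tᵢ` is again a vacuum map. -/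
theorem IsVacuum.sum_dOp (hι : IsVacuum r ι) (hr : Compat r p) (t : Fin 3 → Module.End ℂ W)
    (ht : ∀ g i, t i ∘ₗ r g = r g ∘ₗ t i + ∑ j, rhoMat g (.inl i) (.inl j) • t j)
    (h0 : ∀ b ∈ oddDegGE 0, ∑ i, (∑ a, r (proj (oddBr b (dd i a))) ∘ₗ p a) ∘ₗ t i = 0) :
    IsVacuum r (∑ i, dOp p i ι ∘ₗ t i) where
  even x hx := by
    -- The `tᵢ` transform contragrediently to the `Dᵢ`, so these correction terms cancel those from
    -- `Dᵢ ι` after the two summation indices are exchanged.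
    have hc : ∀ i, (dOp p i ι ∘ₗ r (proj x)) ∘ₗ t i = (dOp p i ι ∘ₗ t i) ∘ₗ r (proj x) -
        ∑ j, rhoMat (proj x) (.inl i) (.inl j) • dOp p i ι ∘ₗ t j := fun i => by
      rw [LinearMap.comp_assoc, LinearMap.comp_assoc, ht, LinearMap.comp_add, comp_sum]
      simp only [LinearMap.comp_smul, add_sub_cancel_right]
    simp only [Finset.smul_sum, comp_smul_eq, hι.ofEven_smul_dOp hr hx, LinearMap.add_comp, hc,
      sum_comp, LinearMap.smul_comp, Finset.sum_add_distrib, Finset.sum_sub_distrib]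
    rw [Finset.sum_comm, sub_add_cancel]
  odd b hb := by
    simp only [Finset.smul_sum, comp_smul_eq, hι.ofOdd_smul_dOp hb]
    simp only [LinearMap.comp_assoc, ← comp_sum, h0 b hb, LinearMap.comp_zero]

end Operators

/-! ### The operator `D₁ D₂ D₃` -/

section Cubic

variable {W M : Type} [AddCommGroup W] [Module ℂ W]
  [AddCommGroup M] [Module ℂ M] [Module U M] [IsScalarTower ℂ U M]
  {p : Fin 2 → Module.End ℂ W} {r : G0 →ₗ⁅ℂ⁆ Module.End ℂ W} {ι : W →ₗ[ℂ] M}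

/-- The action of the elements of degree one on the image of `Dᵢ` in the modules for which `∇₃` is
a morphism. -/
def OddCompat (r : G0 →ₗ⁅ℂ⁆ Module.End ℂ W) (p : Fin 2 → Module.End ℂ W) : Prop :=
  ∀ b ∈ oddDegGE 0, ∀ i, ∑ a, r (proj (oddBr b (dd i a))) ∘ₗ p a =
    (2 * ev0 (b.form 0 i)) • p 1 - (2 * ev0 (b.form 1 i)) • p 0

/-- The coefficients of the action of an odd element on the image of `D₂ D₃`. -/
def oddCoeff (b : Odd) (a : Fin 2) (l : Fin 3) : ℂ :=
  (if l = 2 then ev0 (b.form a 1) else 0) - (if l = 1 then ev0 (b.form a 2) else 0) -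
    ev0 (pd l (pd 0 (b.fn a)))

theorem dOp_comp_p (hp : ∀ a b, p a ∘ₗ p b = p b ∘ₗ p a) (i : Fin 3) (φ : W →ₗ[ℂ] M) (a : Fin 2) :
    dOp p i φ ∘ₗ p a = dOp p i (φ ∘ₗ p a) :=
  dOp_comp i φ (p a) fun b => hp b a

/-- The column of the `gl₃` block that describes what `[b, d₂ᵃ]` does to `D₃`. Since `df ∧ dx₂` is
closed, the trace comes from `x₂ σ` alone. -/
theorem rhoMat_oddBr_dd_one_two {b : Odd} (l : Fin 3) :
    rhoMat (proj (oddBr b (dd 1 0))) (.inl l) (.inl 2) =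
      ev0 (pd l (pd 0 (b.fn 1))) + (if l = 2 then ev0 (b.form 1 1) else 0) -
        (if l = 1 then ev0 (b.form 1 2) else 0) ∧
    rhoMat (proj (oddBr b (dd 1 1))) (.inl l) (.inl 2) =
      -ev0 (pd l (pd 0 (b.fn 0))) - (if l = 2 then ev0 (b.form 0 1) else 0) +
        (if l = 1 then ev0 (b.form 0 2) else 0) := by
  rw [rhoMat_inl, rhoMat_inl, trace_proj, trace_proj, proj_fst, proj_fst, vec_oddBr_dd_zero,
    vec_oddBr_dd_one]
  simp only [d2_sub, d2_add, d2_neg, ← d0_X 1, d2_d0_cross, d2_fsmul, lieFun_X, map_sub, map_add,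
    map_neg, map_zero, map_mul, ev0_X]
  fin_cases l <;> simp [cross_apply, d0, pd_X, ev0_X]

/-- Moving `b` past `D₂` leaves `-D₂ (b D₃ ι)` and `[b, d₂ᵃ]` acting on `D₃ ι`. `OddCompat`
evaluates the first, and the vacuum part of the second; the rest of the second is the rotation of
`D₃` by the `gl₃` block. -/
theorem IsVacuum.ofOdd_smul_dOp_dOp (hι : IsVacuum r ι) (hp : ∀ a b, p a ∘ₗ p b = p b ∘ₗ p a)
    (hr : Compat r p) (hk : OddCompat r p) {b : Odd} (hb : b ∈ oddDegGE 0) :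
    ofOdd Even Odd b • dOp p 1 (dOp p 2 ι) =
      ∑ l, dOp p l (ι ∘ₗ (oddCoeff b 0 l • p 1 - oddCoeff b 1 l • p 0)) := by
  have h1 : ∀ a, ofEven Even Odd (oddBr b (dd 1 a)) • dOp p 2 ι ∘ₗ p a =
      dOp p 2 ι ∘ₗ (r (proj (oddBr b (dd 1 a))) ∘ₗ p a) +
      ∑ l, rhoMat (proj (oddBr b (dd 1 a))) (.inl l) (.inl 2) • dOp p l ι ∘ₗ p a := fun a => by
    rw [comp_smul_eq, hι.ofEven_smul_dOp hr (oddBr_dd_mem hb 1 a), LinearMap.add_comp,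
      sum_comp, LinearMap.comp_assoc]
    simp only [LinearMap.smul_comp]
  rw [E38.ofOdd_smul_dOp, hι.ofOdd_smul_dOp hb, hk b hb]
  simp only [h1]
  rw [Finset.sum_add_distrib, ← comp_sum, hk b hb]
  simp only [Fin.sum_univ_two, Fin.sum_univ_three, rhoMat_oddBr_dd_one_two, oddCoeff,
    LinearMap.comp_sub, LinearMap.comp_smul, dOp_comp_p hp, map_sub, map_smul]
  simp
  module

/-- Together with `ev0_form_lie_dd` this is the component of degree one of `[x, dᵢᵃ]`, the only one
that enters `oddCoeff`. -/
theorem ev0_pd_pd_fn_lie_dd (x : Even) (l m i : Fin 3) (a b : Fin 2) :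
    ev0 (pd l (pd m ((⁅x, dd i a⁆ : Odd).fn b))) =
      (if b = a then ev0 (pd l (pd m (x.vec i))) - (if i = l then ev0 (pd m (d2 x.vec)) / 2 else 0) -
        (if i = m then ev0 (pd l (d2 x.vec)) / 2 else 0) else 0) +
      (if i = l then ev0 (pd m (x.mat b a)) else 0) +
      (if i = m then ev0 (pd l (x.mat b a)) else 0) := by
  rw [fn_lie_dd]
  by_cases h : b = a <;> by_cases h' : i = l <;> by_cases h'' : i = m <;>
    simp [h, h', h'', pd_X, ev0_smul, ev0_X, apply_ite (pd _), apply_ite ev0] <;>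
    ring_nf

theorem ev0_form_lie_dd (x : Even) (i : Fin 3) (a b : Fin 2) (k : Fin 3) :
    ev0 ((⁅x, dd i a⁆ : Odd).form b k) =
      (if b = a then ev0 ((d0 (d2 x.vec) ⨯₃ Pi.single i 1) k) / 2 else 0) +
        ev0 ((d0 (x.mat b a) ⨯₃ Pi.single i 1) k) := by
  rw [form_lie_dd]
  by_cases h : b = a <;> simp [h, ev0_X, ev0_smul]; ring

/-- The quadratic expression by which the elements of degree two act on the image of `D₂ D₃`. -/
def evenQuad (p : Fin 2 → Module.End ℂ W) (x : Even) : Module.End ℂ W :=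
  (4 * ev0 (pd 0 (x.mat 0 0))) • p 0 ∘ₗ p 1 + (2 * ev0 (pd 0 (x.mat 0 1))) • p 1 ∘ₗ p 1 -
    (2 * ev0 (pd 0 (x.mat 1 0))) • p 0 ∘ₗ p 0

/-- The terms linear in `rhoMat` are the Leibniz rule in the exterior algebra of the `Dᵢ`. The last
term is the positive part of `[x, d₂ᵃ]` on `D₃ ι`, evaluated by `OddCompat`. There `d(div X)` enters
with `p₊ p₋ - p₋ p₊ = 0`, so only the linear part of the `sl₂` component survives. -/
theorem IsVacuum.ofEven_smul_dOp_dOp (hι : IsVacuum r ι) (hp : ∀ a b, p a ∘ₗ p b = p b ∘ₗ p a)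
    (hr : Compat r p) (hk : OddCompat r p) {x : Even} (hx : x ∈ evenDegGE 0) :
    ofEven Even Odd x • dOp p 1 (dOp p 2 ι) =
      dOp p 1 (dOp p 2 ι) ∘ₗ r (proj x) +
      (rhoMat (proj x) (.inl 1) (.inl 1) + rhoMat (proj x) (.inl 2) (.inl 2)) •
        dOp p 1 (dOp p 2 ι) -
      rhoMat (proj x) (.inl 0) (.inl 2) • dOp p 0 (dOp p 1 ι) +
      rhoMat (proj x) (.inl 0) (.inl 1) • dOp p 0 (dOp p 2 ι) + ι ∘ₗ evenQuad p x := by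
  rw [ofEven_smul_dOp_of_eq hr (hι.ofEven_smul_dOp hr hx 2) 1]
  have h1 : ∀ a, ofOdd Even Odd (posPart ⁅x, dd 1 a⁆) • dOp p 2 ι ∘ₗ p a =
      ι ∘ₗ (((2 * ev0 ((⁅x, dd 1 a⁆ : Odd).form 0 2)) • p 1 -
        (2 * ev0 ((⁅x, dd 1 a⁆ : Odd).form 1 2)) • p 0) ∘ₗ p a) := fun a => by
    rw [comp_smul_eq, hι.ofOdd_smul_dOp (posPart_lie_dd_mem hx 1 a),
      hk _ (posPart_lie_dd_mem hx 1 a), form_posPart, LinearMap.comp_assoc]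
  simp only [h1, map_add, map_smul, Fin.sum_univ_two, Fin.sum_univ_three, dOp_self hp,
    dOp_dOp hp 1 0, evenQuad, ev0_form_lie_dd, mat_trace x, d0_neg, LinearMap.sub_comp,
    LinearMap.smul_comp, LinearMap.comp_sub, LinearMap.comp_add, LinearMap.comp_smul, hp 1 0]
  simp [cross_apply, d0, map_neg]
  module

/-- If `ι` is a vacuum map for `r`, then `D₁ D₂ D₃ ι` is a vacuum map for the twist of `r`. -/
theorem IsVacuum.dOp_dOp_dOp (hι : IsVacuum r ι) (hp : ∀ a b, p a ∘ₗ p b = p b ∘ₗ p a)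
    (hr : Compat r p) (hk : OddCompat r p) {r' : G0 →ₗ⁅ℂ⁆ Module.End ℂ W}
    (hr' : ∀ g, r g = r' g + (2 * g.1.trace) • LinearMap.id) :
    IsVacuum r' (dOp p 0 (dOp p 1 (dOp p 2 ι))) where
  even x hx := by
    have h := hι.ofEven_smul_dOp_dOp hp hr hk hx
    simp only [add_assoc, sub_eq_add_neg] at h
    rw [ofEven_smul_dOp_of_eq hr h 0]
    have h1 : ∀ a, ofOdd Even Odd (posPart ⁅x, dd 0 a⁆) • dOp p 1 (dOp p 2 ι) ∘ₗ p a =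
        ∑ l, dOp p l (ι ∘ₗ (oddCoeff ⁅x, dd 0 a⁆ 0 l • p 1 - oddCoeff ⁅x, dd 0 a⁆ 1 l • p 0) ∘ₗ
          p a) := fun a => by
      rw [comp_smul_eq, hι.ofOdd_smul_dOp_dOp hp hr hk (posPart_lie_dd_mem hx 0 a)]
      simp only [sum_comp, dOp_comp_p hp, oddCoeff, form_posPart, ev0_pd_pd_fn_posPart,
        LinearMap.comp_assoc]
    -- The diagonal of `A - tr A` adds up to `-2 tr A`, which the shift between `r` and `r'`
    -- compensates. In degree two the `l = 0` term of `h1` cancels `D₁ (ι ∘ evenQuad)`. For `l ≠ 0`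
    -- the `sl₂` parts of `oddCoeff` cancel, and the vector field parts are multiples of `p₊ p₋ - p₋
    -- p₊`.
    rw [hr']
    simp only [h1, map_add, map_neg, map_smul, Fin.sum_univ_two, Fin.sum_univ_three, dOp_self hp,
      dOp_dOp hp 2 1, evenQuad, oddCoeff, ev0_form_lie_dd,
      ev0_pd_pd_fn_lie_dd, mat_trace x, d0_neg, sub_eq_add_neg, LinearMap.add_comp,
      LinearMap.neg_comp, LinearMap.comp_neg,
      LinearMap.smul_comp, LinearMap.comp_add, LinearMap.comp_smul, hp 1 0, rhoMat_inl,
      Matrix.trace_fin_three, LinearMap.comp_id]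
    simp [cross_apply, d0, map_neg]
    module
  odd b hb := by
    have h1 : ∀ a, ofEven Even Odd (oddBr b (dd 0 a)) • dOp p 1 (dOp p 2 ι) ∘ₗ p a =
        dOp p 1 (dOp p 2 ι) ∘ₗ (r (proj (oddBr b (dd 0 a))) ∘ₗ p a) +
        ((rhoMat (proj (oddBr b (dd 0 a))) (.inl 1) (.inl 1) +
          rhoMat (proj (oddBr b (dd 0 a))) (.inl 2) (.inl 2)) • dOp p 1 (dOp p 2 (ι ∘ₗ p a)) -
        rhoMat (proj (oddBr b (dd 0 a))) (.inl 0) (.inl 2) • dOp p 0 (dOp p 1 (ι ∘ₗ p a)) +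
        rhoMat (proj (oddBr b (dd 0 a))) (.inl 0) (.inl 1) • dOp p 0 (dOp p 2 (ι ∘ₗ p a))) +
        ι ∘ₗ (evenQuad p (oddBr b (dd 0 a)) ∘ₗ p a) := fun a => by
      rw [comp_smul_eq, hι.ofEven_smul_dOp_dOp hp hr hk (oddBr_dd_mem hb 0 a)]
      simp only [LinearMap.add_comp, LinearMap.sub_comp, LinearMap.smul_comp, LinearMap.comp_assoc,
        dOp_comp_p hp]
      abel
    -- The contribution of the component of degree three of `b`: a cubic expression in the commuting
    -- `pₐ` whose monomials cancel in pairs.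
    have h2 : ∑ a, evenQuad p (oddBr b (dd 0 a)) ∘ₗ p a = 0 := by
      have h3 : ∀ T : Module.End ℂ W, p 1 ∘ₗ p 0 ∘ₗ T = p 0 ∘ₗ p 1 ∘ₗ T := fun T => by
        rw [← LinearMap.comp_assoc, hp 1 0, LinearMap.comp_assoc]
      rw [Fin.sum_univ_two]
      simp only [evenQuad, LinearMap.add_comp, LinearMap.sub_comp, LinearMap.smul_comp,
        LinearMap.comp_assoc, hp 1 0, h3, mat_oddBr_dd_zero, mat_oddBr_dd_one]
      simp [pd_neg, ev0_smul]
      module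
    rw [E38.ofOdd_smul_dOp, hι.ofOdd_smul_dOp_dOp hp hr hk hb]
    simp only [h1]
    -- What is left comes from degree one. The `OddCompat` term on `D₂ D₃` is cancelled by the
    -- diagonal of the `gl₃` block, and `-D₁ (b D₂ D₃ ι)` by its off-diagonal entries.
    rw [Finset.sum_add_distrib, Finset.sum_add_distrib, ← comp_sum, ← comp_sum, h2, hk b hb]
    simp only [Fin.sum_univ_two, Fin.sum_univ_three, oddCoeff, rhoMat_inl, trace_proj, proj_fst,
      vec_oddBr_dd_zero, vec_oddBr_dd_one, d2_sub, d2_add, d2_neg, ← d0_X 0, d2_d0_cross,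
      d2_fsmul, lieFun_X, LinearMap.comp_sub, LinearMap.comp_smul, dOp_comp_p hp, map_sub, map_smul,
      map_add, map_neg, dOp_self hp]
    simp [cross_apply, d0, pd_X, ev0_X, pd10, pd20, pd21]
    module

end Cubic

/-! ### The Fock modules -/

section Fock

variable (X : Quadrant)

theorem derOp_quadOp (B : Matrix Var Var ℂ) (k : Var) :
    derOp X k * quadOp X B = quadOp X B * derOp X k + ∑ l, B k l • derOp X l := by
  have h : ∀ m l, derOp X k * (posOp X m * derOp X l) =
      posOp X m * derOp X l * derOp X k + if k = m then derOp X l else 0 := fun m l => by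
    rw [← mul_assoc, derOp_posOp, add_mul, mul_assoc, derOp_comm X k l, mul_assoc]
    split_ifs <;> simp
  simp only [quadOp, Finset.mul_sum, Finset.sum_mul, mul_smul_comm, smul_mul_assoc, h, smul_add,
    Finset.sum_add_distrib, smul_ite, smul_zero]
  congr 1
  rw [Finset.sum_comm]
  simp

theorem rho_eq (g : G0) : rho X g = quadOp X (rhoMat g) := rhoFun_eq X g

theorem derOp_inl_comp_rho (g : G0) (i : Fin 3) :
    derOp X (.inl i) ∘ₗ rho X g = rho X g ∘ₗ derOp X (.inl i) +
      ∑ j, rhoMat g (.inl i) (.inl j) • derOp X (.inl j) := by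
  have h := derOp_quadOp X (rhoMat g) (.inl i)
  have h0 : ∀ a, rhoMat g (.inl i) (.inr a) = 0 := fun _ => rfl
  simp only [Fintype.sum_sum_type, ← rho_eq, h0, zero_smul, Finset.sum_const_zero, add_zero] at h
  exact h

/-- `rhoMat` is block diagonal, so commuting `∂ₐ` with `𝔤₀` never produces a `∂ᵢ`. -/
theorem compat_rho : Compat (rho X) fun a => derOp X (.inr a) := by
  intro g a
  have h := derOp_quadOp X (rhoMat g) (.inr a)
  have h0 : ∀ i, rhoMat g (.inr a) (.inl i) = 0 := fun _ => rfl
  simp only [Fintype.sum_sum_type, ← rho_eq, h0, zero_smul, Finset.sum_const_zero, zero_add] at h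
  exact h

theorem compat_rhoZ : Compat (rhoZ X) (derZ X) := by
  intro g a
  refine LinearMap.ext fun f => Subtype.ext ?_
  refine (LinearMap.congr_fun (compat_rho X g a) f.1).trans ?_
  simp [derZ, rhoZ]

theorem derOp_comp_comm (k l : Var) : derOp X k ∘ₗ derOp X l = derOp X l ∘ₗ derOp X k :=
  derOp_comm X k l

theorem derZ_comm (a b : Fin 2) : derZ X a ∘ₗ derZ X b = derZ X b ∘ₗ derZ X a :=
  LinearMap.ext fun f => Subtype.ext (LinearMap.congr_fun (derOp_comm X (.inr a) (.inr b)) f.1)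

theorem derOp_apply_comm (k l : Var) (v : V) : derOp X k (derOp X l v) = derOp X l (derOp X k v) :=
  LinearMap.congr_fun (derOp_comm X k l) v

theorem rho_apply (g : G0) (v : V) :
    rho X g v = ∑ l, ∑ i, rhoMat g (.inl l) (.inl i) • posOp X (.inl l) (derOp X (.inl i) v) +
      ∑ a, ∑ b, rhoMat g (.inr a) (.inr b) • posOp X (.inr a) (derOp X (.inr b) v) := by
  rw [rho_eq, quadOp]
  simp [Fintype.sum_sum_type, rhoMat]

/-- Holds in `H`, hence for all four `X`. The terms with `df ∧ dxᵢ` are skew against the symmetric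
`∂ᵢ ∂ⱼ`. The terms `xᵢ σ` cancel against the trace subtracted in `rhoMat`, both giving `∑ xₗ ∂ₗ`
times `∑ σⱼ ∂ⱼ`. The `z` part cancels between `a = +` and `a = -` since `∂₊` and `∂₋` commute. -/
theorem sum_rho_oddBr (b : Odd) :
    ∑ i, (∑ a, rho X (proj (oddBr b (dd i a))) ∘ₗ derOp X (.inr a)) ∘ₗ derOp X (.inl i) = 0 := by
  refine LinearMap.ext fun v => ?_
  simp only [Fin.sum_univ_two, Fin.sum_univ_three, LinearMap.add_comp, LinearMap.add_apply,
    LinearMap.comp_apply, rho_apply, rhoMat_inl, rhoMat_inr, trace_proj, proj_fst, proj_snd,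
    vec_oddBr_dd_zero, vec_oddBr_dd_one, mat_oddBr_dd_zero, mat_oddBr_dd_one, d2_sub, d2_add,
    d2_neg, ← d0_X, d2_d0_cross, d2_fsmul, lieFun_X, ooK_X]
  simp [cross_apply, d0, pd_X, ev0_X, ev0_smul, pd10, pd20, pd21,
    derOp_apply_comm X (.inl 1) (.inl 0), derOp_apply_comm X (.inl 2) (.inl 0),
    derOp_apply_comm X (.inl 2) (.inl 1), derOp_apply_comm X (.inr 1) (.inr 0),
    derOp_apply_comm X (.inr _) (.inl _)]
  module

/-- If `xᵢ ∈ L_X`, then `∂ᵢ` annihilates `V_{X''}`. Otherwise `xₗ ∂ᵢ` acts as `-δₗᵢ`, and the scalar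
is `-tr (A - tr A) = 2 tr A`. -/
theorem rho_apply_of_mem (g : G0) (f : V) (hf : f ∈ Vz) :
    rho X g f = (if X.pos (.inl 0) then (0 : ℂ) else 2 * g.1.trace) • f +
      ∑ a, ∑ b, rhoMat g (.inr a) (.inr b) • posOp X (.inr a) (derOp X (.inr b) f) := by
  rw [rho_apply]
  congr 1
  have h : ∀ k, X.pos (.inl k) = X.pos (.inl 0) := by
    cases X <;> exact fun _ => rfl
  have h2 : ∀ l i, posOp X (.inl l) (derOp X (.inl i) f) =
      if X.pos (.inl 0) then 0 else if l = i then -f else 0 := fun l i => by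
    unfold posOp derOp
    rw [h l, h i]
    split_ifs with _ h3
    · simp [pderiv_inl i f hf]
    · simp [pderiv_inl i f hf, h3, Derivation.leibniz]
    · simp [pderiv_inl l f hf, Derivation.leibniz, Ne.symm h3]
  simp only [h2]
  split_ifs
  · simp
  · simp only [Fin.sum_univ_three, rhoMat_inl, Matrix.trace_fin_three]
    simp
    module

/-- The traces of the linear parts of `[b, dᵢ⁺]` and `[b, dᵢ⁻]` are `-σ₋(i)` and `σ₊(i)`. The scalar
`2 tr A`, present only for `X = C, D`, turns them into the right-hand side; the terms `z ∂ ∂` cancel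
as in `sum_rho_oddBr`. -/
theorem oddCompat_rhoZ (hX : X.pos (.inl 0) = false) : OddCompat (rhoZ X) (derZ X) := by
  intro b hb i
  refine LinearMap.ext fun f => Subtype.ext ?_
  have h : ∀ g (f : Vz), (rhoZ X g f).1 = rho X g f.1 := fun _ _ => rfl
  have h' : ∀ a (f : Vz), (derZ X a f).1 = derOp X (.inr a) f.1 := fun _ _ => rfl
  have hm := fun a => derOp_mem X a f.1 f.2
  simp only [Fin.sum_univ_two, LinearMap.add_apply, LinearMap.sub_apply, LinearMap.smul_apply,
    LinearMap.comp_apply, Submodule.coe_add, Submodule.coe_sub, Submodule.coe_smul, h, h',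
    rho_apply_of_mem X _ _ (hm _), hX, rhoMat_inr, trace_proj, proj_snd,
    vec_oddBr_dd_zero, vec_oddBr_dd_one, mat_oddBr_dd_zero, mat_oddBr_dd_one, d2_sub, d2_add,
    d2_neg, ← d0_X, d2_d0_cross, d2_fsmul, lieFun_X, ooK_X]
  simp [ev0_X, ev0_smul, derOp_apply_comm X (.inr 1) (.inr 0)]
  module

/-! ### The retraction of `V_X` onto `V_{X''}` -/

/-- The projection `xᵢ ↦ 0` of `V_X` onto `V_{X''}`. -/
def setZero : V →ₐ[ℂ] V :=
  MvPolynomial.aeval (Sum.elim (fun _ => 0) fun a => MvPolynomial.X (.inr a))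

theorem setZero_mem (f : V) : setZero f ∈ Vz := by
  have h : setZero.range ≤ MvPolynomial.supported ℂ (Set.range (Sum.inr : Fin 2 → Var)) := by
    rw [setZero, ← Algebra.adjoin_range_eq_range_aeval, Algebra.adjoin_le_iff]
    rintro _ ⟨k | a, rfl⟩
    · exact zero_mem (MvPolynomial.supported ℂ _)
    · exact MvPolynomial.X_mem_supported.2 ⟨a, rfl⟩
  exact h ⟨f, rfl⟩

theorem setZero_of_mem (f : V) (hf : f ∈ Vz) : setZero f = f := by
  have h : MvPolynomial.supported ℂ (Set.range (Sum.inr : Fin 2 → Var)) ≤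
      AlgHom.equalizer setZero (AlgHom.id ℂ V) := by
    rw [MvPolynomial.supported, Algebra.adjoin_le_iff]
    rintro _ ⟨_, ⟨a, rfl⟩, rfl⟩
    simp [setZero]
  exact h hf

theorem setZero_pderiv (a : Fin 2) (f : V) :
    setZero (MvPolynomial.pderiv (.inr a) f) = MvPolynomial.pderiv (.inr a) (setZero f) := by
  induction f using MvPolynomial.induction_on with
  | C c => simp [setZero]
  | add f g hf hg => simp only [map_add, hf, hg]
  | mul_X f k hf =>
    simp only [Derivation.leibniz, map_mul, map_add, smul_eq_mul, hf, MvPolynomial.pderiv_X]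
    rcases k with i | b
    · simp [setZero]
    · simp only [setZero, MvPolynomial.aeval_X, Sum.elim_inr, MvPolynomial.pderiv_X, Pi.single_apply,
        apply_ite, map_one, map_zero]

theorem setZero_posOp (a : Fin 2) (f : V) :
    setZero (posOp X (.inr a) f) = posOp X (.inr a) (setZero f) := by
  unfold posOp
  split_ifs
  · simp [setZero]
  · simp [setZero_pderiv]

theorem setZero_derOp (a : Fin 2) (f : V) :
    setZero (derOp X (.inr a) f) = derOp X (.inr a) (setZero f) := by
  unfold derOp
  split_ifs
  · simp [setZero_pderiv]
  · simp [setZero]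

variable {X} in
-- For `X = A, B` every `xₗ ∂ᵢ` has image in the ideal generated by the `xₗ`, which is set to zero,
-- and kills `V_{X''}`. So only the `z` block acts on either side.
theorem setZero_rho (hX : X.pos (.inl 0) = true) (g : G0) (f : V) :
    setZero (rho X g f) = rho X g (setZero f) := by
  have h : ∀ k, X.pos (.inl k) = true := by
    cases X
    · exact fun _ => rfl
    · exact fun _ => rfl
    · exact fun _ => hX
    · exact fun _ => hX
  have h2 : ∀ l v, setZero (posOp X (.inl l) v) = 0 := fun l v => by
    simp [posOp, h, setZero]
  rw [rho_apply_of_mem X g _ (setZero_mem f), rho_apply]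
  simp only [map_add, map_sum, map_smul, h2, setZero_posOp, setZero_derOp, hX, if_true, zero_smul,
    smul_zero, Finset.sum_const_zero]

/-- The projection of `V_X` onto `V_{X''}`, with values in `V_{X''}`. -/
def retr : V →ₗ[ℂ] Vz := setZero.toLinearMap.codRestrict Vz setZero_mem

theorem retr_subtype (f : Vz) : retr f = f := Subtype.ext (setZero_of_mem f.1 f.2)

theorem derZ_comp_retr (a : Fin 2) : derZ X a ∘ₗ retr = retr ∘ₗ derOp X (.inr a) :=
  LinearMap.ext fun f => Subtype.ext (setZero_derOp X a f).symm

end Fock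

/-! ### Maps out of induced modules -/

section Verma

variable {W W' M : Type} [AddCommGroup W] [Module ℂ W] [AddCommGroup W'] [Module ℂ W']
  [AddCommGroup M] [Module ℂ M] [Module U M] [IsScalarTower ℂ U M]
  (r : G0 →ₗ⁅ℂ⁆ Module.End ℂ W) {r' : G0 →ₗ⁅ℂ⁆ Module.End ℂ W'}

instance : Module ℂ (Verma r) := inferInstanceAs (Module ℂ ((U ⊗[ℂ] W) ⧸ vermaRel r))

instance : IsScalarTower ℂ U (Verma r) :=
  inferInstanceAs (IsScalarTower ℂ U ((U ⊗[ℂ] W) ⧸ vermaRel r))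

/-- The map `w ↦ 1 ⊗ w`. -/
def vac : W →ₗ[ℂ] Verma r :=
  (vermaRel r).mkQ.restrictScalars ℂ ∘ₗ TensorProduct.mk ℂ U W 1

theorem smul_tmul' (u v : U) (w : W) : u • Verma.tmul r v w = Verma.tmul r (u * v) w := by
  unfold Verma.tmul
  exact ((vermaRel r).mkQ.map_smul u (v ⊗ₜ[ℂ] w)).symm

theorem tmul_eq_smul_vac (u : U) (w : W) : Verma.tmul r u w = u • vac r w := by
  change _ = u • Verma.tmul r 1 w
  rw [smul_tmul', mul_one]

theorem isVacuum_vac : IsVacuum r (vac r) where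
  even x hx := by
    refine LinearMap.ext fun w => ?_
    change ofEven Even Odd x • vac r w = vac r _
    rw [← tmul_eq_smul_vac]
    exact (Submodule.Quotient.eq _).2 (Submodule.subset_span (Or.inl ⟨x, hx, w, rfl⟩))
  odd b hb := by
    refine LinearMap.ext fun w => ?_
    change ofOdd Even Odd b • vac r w = 0
    rw [← tmul_eq_smul_vac]
    exact (Submodule.Quotient.mk_eq_zero _).2 (Submodule.subset_span (Or.inr ⟨b, hb, w, rfl⟩))

variable {r}

/-- The morphism of modules out of an induced module that is given by a vacuum map. -/
def Verma.lift (ι : W →ₗ[ℂ] M) (h : IsVacuum r ι) : Verma r →ₗ[U] M :=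
  (vermaRel r).liftQ
    (TensorProduct.AlgebraTensorModule.lift (LinearMap.toSpanSingleton U (W →ₗ[ℂ] M) ι)) (by
    rw [vermaRel, Submodule.span_le]
    rintro t (⟨x, hx, w, rfl⟩ | ⟨a, ha, w, rfl⟩)
    · refine LinearMap.mem_ker.2 ?_
      rw [map_sub, sub_eq_zero]
      refine (LinearMap.congr_fun (h.even x hx) w).trans ?_
      exact (one_smul U (ι (r (proj x) w))).symm
    · exact LinearMap.mem_ker.2 (LinearMap.congr_fun (h.odd a ha) w))

theorem Verma.lift_tmul (ι : W →ₗ[ℂ] M) (h : IsVacuum r ι) (u : U) (w : W) :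
    Verma.lift ι h (Verma.tmul r u w) = u • ι w :=
  rfl

theorem Verma.lift_vac (ι : W →ₗ[ℂ] M) (h : IsVacuum r ι) :
    (Verma.lift ι h).restrictScalars ℂ ∘ₗ vac r = ι :=
  LinearMap.ext fun w => (Verma.lift_tmul ι h 1 w).trans (one_smul _ _)

theorem Verma.map_vac (f : W →ₗ[ℂ] W') (hf : ∀ g w, f (r g w) = r' g (f w)) :
    (Verma.map f hf).restrictScalars ℂ ∘ₗ vac r = vac r' ∘ₗ f := rfl

theorem restrictScalars_comp_comp {M₁ M₂ : Type} [AddCommGroup M₁] [Module ℂ M₁] [Module U M₁]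
    [IsScalarTower ℂ U M₁] [AddCommGroup M₂] [Module ℂ M₂] [Module U M₂] [IsScalarTower ℂ U M₂]
    (F : M₁ →ₗ[U] M₂) (G : M →ₗ[U] M₁) (φ : W →ₗ[ℂ] M) :
    (F ∘ₗ G).restrictScalars ℂ ∘ₗ φ = F.restrictScalars ℂ ∘ₗ (G.restrictScalars ℂ ∘ₗ φ) := rfl

/-- The projection of `U ⊗ W` onto the induced module. -/
def Verma.mk (r : G0 →ₗ⁅ℂ⁆ Module.End ℂ W) : U ⊗[ℂ] W →ₗ[U] Verma r := (vermaRel r).mkQ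

/-- A morphism out of an induced module that vanishes on the elements `1 ⊗ w` is zero. -/
theorem Verma.eq_zero (F : Verma r →ₗ[U] M) (h : F.restrictScalars ℂ ∘ₗ vac r = 0) (m : Verma r) :
    F m = 0 := by
  obtain ⟨t, rfl⟩ : ∃ t, Verma.mk r t = m := (vermaRel r).mkQ_surjective m
  change (F ∘ₗ Verma.mk r) t = 0
  induction t using TensorProduct.induction_on with
  | zero => exact map_zero _
  | add s t hs ht => rw [map_add, hs, ht, add_zero]
  | tmul u w =>
    change F (Verma.tmul r u w) = 0
    rw [tmul_eq_smul_vac, map_smul]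
    exact (congrArg (u • ·) (LinearMap.congr_fun h w)).trans (smul_zero u)

end Verma

/-! ### The morphisms `∇` and `∇₃` -/

theorem isVacuum_nabla (X : Quadrant) :
    IsVacuum (rho X) (∑ i, dOp (fun a => derOp X (.inr a)) i (vac (rho X)) ∘ₗ derOp X (.inl i)) :=
  (isVacuum_vac (rho X)).sum_dOp (compat_rho X) _ (derOp_inl_comp_rho X) fun b _ => sum_rho_oddBr X b

/-- The morphism `∇`. -/
def nabla (X : Quadrant) : M X →ₗ[U] M X := Verma.lift _ (isVacuum_nabla X)

theorem nabla_vac (X : Quadrant) : (nabla X).restrictScalars ℂ ∘ₗ vac (rho X) =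
    ∑ i, dOp (fun a => derOp X (.inr a)) i (vac (rho X)) ∘ₗ derOp X (.inl i) :=
  Verma.lift_vac _ _

theorem isNabla_nabla (X : Quadrant) : IsNabla X (nabla X) := by
  intro u v
  rw [nabla, Verma.lift_tmul]
  simp only [LinearMap.sum_apply, LinearMap.comp_apply, dOp_eq_sum, LinearMap.smul_apply,
    Finset.smul_sum, tmul_eq_smul_vac, mul_smul, derOp_apply_comm X (.inr _) (.inl _)]

theorem incl_vac (X : Quadrant) :
    (incl X).restrictScalars ℂ ∘ₗ vac (rhoZ X) = vac (rho X) ∘ₗ Vz.subtype := rfl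

/-- Source and target have the same underlying space `Vz` and the same `∂ₐ`; their `𝔤₀`-actions
differ only by the character that `D₁ D₂ D₃` absorbs. -/
theorem isVacuum_nabla3 {X Y : Quadrant} (hp : derZ X = derZ Y) (hY : Y.pos (.inl 0) = false)
    (hr : ∀ g, rhoZ Y g = rhoZ X g + (2 * g.1.trace) • LinearMap.id) :
    IsVacuum (rhoZ X) (dOp (derZ X) 0 (dOp (derZ X) 1 (dOp (derZ X) 2 (vac (rhoZ Y))))) := by
  rw [hp]
  exact (isVacuum_vac (rhoZ Y)).dOp_dOp_dOp (derZ_comm Y) (compat_rhoZ Y) (oddCompat_rhoZ Y hY) hr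

theorem rhoZ_eq_add {X Y : Quadrant} (h : ∀ a, X.pos (.inr a) = Y.pos (.inr a))
    (hX : X.pos (.inl 0) = true) (hY : Y.pos (.inl 0) = false) (g : G0) :
    rhoZ Y g = rhoZ X g + (2 * g.1.trace) • LinearMap.id := by
  refine LinearMap.ext fun f => Subtype.ext ?_
  change rho Y g f.1 = rho X g f.1 + (2 * g.1.trace) • f.1
  rw [rho_apply_of_mem X g _ f.2, rho_apply_of_mem Y g _ f.2, hX, hY]
  simp only [posOp, derOp, h, if_true, Bool.false_eq_true, if_false, zero_smul, zero_add]
  exact add_comm _ _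

theorem derZ_eq {X Y : Quadrant} (h : ∀ a, X.pos (.inr a) = Y.pos (.inr a)) : derZ X = derZ Y := by
  funext a
  refine LinearMap.ext fun f => Subtype.ext ?_
  change derOp X (.inr a) f.1 = derOp Y (.inr a) f.1
  simp [derOp, h]

/-- The morphism `∇₃`. -/
def nabla3 {X Y : Quadrant} (h : ∀ a, X.pos (.inr a) = Y.pos (.inr a))
    (hX : X.pos (.inl 0) = true) (hY : Y.pos (.inl 0) = false) : MZ X →ₗ[U] MZ Y :=
  Verma.lift _ (isVacuum_nabla3 (derZ_eq h) hY (rhoZ_eq_add h hX hY))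

section

variable {X Y : Quadrant} (h : ∀ a, X.pos (.inr a) = Y.pos (.inr a))
  (hX : X.pos (.inl 0) = true) (hY : Y.pos (.inl 0) = false)

theorem nabla3_vac : (nabla3 h hX hY).restrictScalars ℂ ∘ₗ vac (rhoZ X) =
    dOp (derZ X) 0 (dOp (derZ X) 1 (dOp (derZ X) 2 (vac (rhoZ Y)))) :=
  Verma.lift_vac _ _

theorem isNabla3_nabla3 : IsNabla3 X Y (nabla3 h hX hY) := by
  intro u f
  have hc : ∀ a b f, derZ Y a (derZ Y b f) = derZ Y b (derZ Y a f) := fun a b f =>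
    LinearMap.congr_fun (derZ_comm Y a b) f
  -- Nested `Dᵢ` apply the `∂` in the order opposite to that in the formula for `∇₃`.
  have hs : ∀ a b c, derZ Y c (derZ Y b (derZ Y a f)) = derZ Y a (derZ Y b (derZ Y c f)) :=
    fun a b c => by rw [hc b a, hc c a, hc c b]
  rw [nabla3, Verma.lift_tmul, derZ_eq h]
  simp only [dOp_eq_sum, LinearMap.sum_apply, LinearMap.comp_apply, LinearMap.smul_apply,
    Finset.smul_sum, tmul_eq_smul_vac, mul_smul, hs]

/-! ### Vanishing of `∇∇₃` and `∇₃∇` -/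

theorem nabla_nabla3 (m : MZ X) : nabla Y (incl Y (nabla3 h hX hY m)) = 0 := by
  refine Verma.eq_zero (nabla Y ∘ₗ incl Y ∘ₗ nabla3 h hX hY) ?_ m
  -- Here `∂ᵢ` is multiplication by a variable and leaves `V_{Y''}`. It commutes with `∂ₐ`, so it
  -- can be absorbed into the map to which `Dᵢ` is applied.
  have h1 : ∀ i, (dOp (fun a => derOp Y (.inr a)) i (vac (rho Y)) ∘ₗ derOp Y (.inl i)) ∘ₗ
      Vz.subtype = dOp (derZ Y) i (vac (rho Y) ∘ₗ derOp Y (.inl i) ∘ₗ Vz.subtype) := fun i => by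
    rw [LinearMap.comp_assoc]
    refine dOp_comp i _ _ fun a => ?_
    rw [← LinearMap.comp_assoc, derOp_comp_comm]
    rfl
  rw [restrictScalars_comp_comp, restrictScalars_comp_comp, nabla3_vac, derZ_eq h]
  simp only [comp_dOp]
  rw [incl_vac, ← LinearMap.comp_assoc, nabla_vac, sum_comp]
  simp only [h1]
  simp only [map_sum]
  refine Finset.sum_eq_zero fun i _ => ?_
  have hc := derZ_comm Y
  rw [dOp_dOp hc 2 i, map_neg, map_neg, dOp_dOp hc 1 i, map_neg, neg_neg, dOp_dOp hc 0 i,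
    dOp_dOp_dOp_dOp hc, neg_zero]

/-- The retraction `π` recovers `n = π (∇ m)`, so it is enough that `∇₃ π ∇` vanishes on all of
`M(V_X)`. -/
theorem nabla3_eq_zero (m : M X) (n : MZ X) (hmn : nabla X m = incl X n) :
    nabla3 h hX hY n = 0 := by
  let π : M X →ₗ[U] MZ X := Verma.map retr fun g v => Subtype.ext (setZero_rho hX g v)
  have hπ : ∀ n, π (incl X n) = n := fun n => by
    rw [← sub_eq_zero]
    refine Verma.eq_zero (π ∘ₗ incl X - LinearMap.id) ?_ n
    refine LinearMap.ext fun f => ?_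
    change vac (rhoZ X) (retr f) - vac (rhoZ X) f = 0
    rw [retr_subtype, sub_self]
  rw [← hπ n, ← hmn]
  refine Verma.eq_zero (nabla3 h hX hY ∘ₗ π ∘ₗ nabla X) ?_ m
  have h1 : π.restrictScalars ℂ ∘ₗ vac (rho X) = vac (rhoZ X) ∘ₗ retr := Verma.map_vac _ _
  rw [restrictScalars_comp_comp, restrictScalars_comp_comp, nabla_vac, comp_sum, comp_sum]
  refine Finset.sum_eq_zero fun i _ => ?_
  -- `π` and `∇₃` are `U`-linear and pass inside `Dᵢ`; the retraction commutes with `∂ₐ` and passes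
  -- inside `D₁ D₂ D₃`. The summand becomes `Dᵢ D₁ D₂ D₃` of a map, followed by `∂ᵢ`.
  rw [← LinearMap.comp_assoc (derOp X (.inl i)), ← LinearMap.comp_assoc (derOp X (.inl i)),
    comp_dOp, comp_dOp, h1, ← LinearMap.comp_assoc, nabla3_vac, dOp_comp _ _ _ (derZ_comp_retr X),
    dOp_comp _ _ _ (derZ_comp_retr X), dOp_comp _ _ _ (derZ_comp_retr X),
    dOp_dOp_dOp_dOp fun a b => derOp_comp_comm X (.inr a) (.inr b), LinearMap.zero_comp]

end

end E38

end

theorem proposition3p4 :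
    ∃ (nabla : ∀ X : E38.Quadrant, E38.M X →ₗ[E38.U] E38.M X)
      (nablaAC : E38.MZ .A →ₗ[E38.U] E38.MZ .C)
      (nablaBD : E38.MZ .B →ₗ[E38.U] E38.MZ .D),
      (∀ X, E38.IsNabla X (nabla X)) ∧
      E38.IsNabla3 .A .C nablaAC ∧ E38.IsNabla3 .B .D nablaBD ∧
      (∀ m, nabla .C (E38.incl .C (nablaAC m)) = 0) ∧
      (∀ m, nabla .D (E38.incl .D (nablaBD m)) = 0) ∧
      (∀ m n, nabla .A m = E38.incl .A n → nablaAC n = 0) ∧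
      (∀ m n, nabla .B m = E38.incl .B n → nablaBD n = 0) := by
  have hAC : ∀ a, E38.Quadrant.pos .A (.inr a) = E38.Quadrant.pos .C (.inr a) := fun _ => rfl
  have hBD : ∀ a, E38.Quadrant.pos .B (.inr a) = E38.Quadrant.pos .D (.inr a) := fun _ => rfl
  exact ⟨E38.nabla, E38.nabla3 hAC rfl rfl, E38.nabla3 hBD rfl rfl, E38.isNabla_nabla,
    E38.isNabla3_nabla3 hAC rfl rfl, E38.isNabla3_nabla3 hBD rfl rfl,
    E38.nabla_nabla3 hAC rfl rfl, E38.nabla_nabla3 hBD rfl rfl,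
    E38.nabla3_eq_zero hAC rfl rfl, E38.nabla3_eq_zero hBD rfl rfl⟩
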